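/- **Setting.** Let $\Omega\subset\mathbb R^3$ be a bounded open set, $T>0$, $\tfrac32<p<\infty$, and let $Y=[-\tfrac12,\tfrac12)^3$ be the unit period cell. Let $\lambda,\gamma,\delta,\rho_f,\rho_m,C_f,C_m,C_i$ be positive constants, let $F\subseteq Y$ be measurable (the inclusion phase), let $\chi_f$ be the $Y$-periodic extension of the indicator function of $F$, let $\chi_m=1-\chi_f$, and put $$\rho=\chi_f\rho_f+\chi_m\rho_m,\qquad \alpha(y,\hat y)=C_f\chi_f(y)\chi_f(\hat y)+C_m\chi_m(y)\chi_m(\hat y)+C_i\big(\chi_f(y)\chi_m(\hat y)+\chi_m(y)\chi_f(\hat y)\big).$$ Write $H_r(x)$ for the ball of radius $r$ about $x$, and $L^p_{\rm per}(Y;C(\overline\Omega)^3)$ for the space of functions $\psi(x,y)$ that are $Y$-periodic in $y$ and, as functions of $y\in Y$, are $L^p$ functions with values in the Banach space $C(\overline\Omega)^3$ with the sup norm. Let $u_0,v_0\in L^p_{\rm per}(Y;C(\overline\Omega)^3)$ and $b\in C([0,T];L^p_{\rm per}(Y;C(\overline\Omega)^3))$. For $\varepsilon>0$ let $u^\varepsilon\in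 C^2([0,T];L^p(\Omega)^3)$ be the solution of the heterogeneous peridynamic problem $$\rho\big(\tfrac x\varepsilon\big)\partial_t^2u^\varepsilon(x,t)=\int_{H_\gamma(x)\cap\Omega}\lambda\frac{(\hat x-x)\otimes(\hat x-x)}{|\hat x-x|^3}\big(u^\varepsilon(\hat x,t)-u^\varepsilon(x,t)\big)d\hat x+\int_{H_{\varepsilon\delta}(x)\cap\Omega}\frac1{\varepsilon^2}\alpha\big(\tfrac x\varepsilon,\tfrac{\hat x}\varepsilon\big)\frac{(\hat x-x)\otimes(\hat x-x)}{|\hat x-x|^3}\big(u^\varepsilon(\hat x,t)-u^\varepsilon(x,t)\big)d\hat x+b\big(x,\tfrac x\varepsilon,t\big)$$ (for every $t\in[0,T]$ and almost every $x\in\Omega$) with $u^\varepsilon(x,0)=u_0(x,\tfrac x\varepsilon)$ and $\partial_tu^\varepsilon(x,0)=v_0(x,\tfrac x\varepsilon)$. Let $u\in C^2([0,T];L^p_{\rm per}(Y;C(\overline\Omega)^3))$ be the solution of the two-scale peridynamic problem $$\rho(y)\partial_t^2u(x,y,t)=\int_{H_\gamma(x)\cap\Omega}\lambda\frac{(\hat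 x-x)\otimes(\hat x-x)}{|\hat x-x|^3}\Big(\int_Yu(\hat x,y',t)\,dy'-u(x,y,t)\Big)d\hat x+\int_{H_\delta(y)}\alpha(y,\hat y)\frac{(\hat y-y)\otimes(\hat y-y)}{|\hat y-y|^3}\big(u(x,\hat y,t)-u(x,y,t)\big)d\hat y+b(x,y,t)$$ (for every $t\in[0,T]$, almost every $y\in Y$ and every $x\in\Omega$) with $u(x,y,0)=u_0(x,y)$ and $\partial_tu(x,y,0)=v_0(x,y)$. **Theorem 3.12.** For every $t\in[0,T]$, $$\lim_{\varepsilon\to0}\big\|u^\varepsilon(x,t)-u\big(x,\tfrac x\varepsilon,t\big)\big\|_{L^p(\Omega)^3}=0 .$$ The same holds if $\varepsilon$ is restricted to a set of positive scales, such as $\varepsilon=1/n$, $n=1,2,\dots$, and $u^\varepsilon$ is given only for these. -/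

import Mathlib

open MeasureTheory Set Filter
open scoped ENNReal Topology BoundedContinuousFunction

noncomputable section

namespace Peridynamics

/-- Three-dimensional Euclidean space (Euclidean norm, Lebesgue measure as `volume`). -/
abbrev E3 : Type := EuclideanSpace ℝ (Fin 3)

/-- The unit period cube `Y`, centred at the origin. -/
def unitCell : Set E3 := {y | ∀ i, -(1 / 2 : ℝ) ≤ y i ∧ y i < 1 / 2}

/-- The point of `unitCell` that is congruent to `y` modulo `ℤ³`. Composing with `cellRep`
extends a function on `unitCell` to a `Y`-periodic function on all of space. -/
def cellRep (y : E3) : E3 :=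
  WithLp.toLp 2 (fun i => Int.fract (y i + 1 / 2) - 1 / 2)

/-- The vector `(ξ ⊗ ξ / |ξ|³) η = (ξ · η) ξ / |ξ|³`. -/
def bond (ξ η : E3) : E3 := (inner ℝ ξ η / ‖ξ‖ ^ 3) • ξ

/-- The parameters of a two-phase periodic peridynamic medium. -/
structure Medium where
  /-- strength of the long-range bonds -/
  lam : ℝ
  /-- horizon of the long-range bonds -/
  γ : ℝ
  /-- (unscaled) horizon of the short-range bonds -/
  δ : ℝ
  /-- density of the inclusion phase -/
  ρf : ℝ
  /-- density of the matrix phase -/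
  ρm : ℝ
  /-- strength of short-range bonds inside the inclusion phase -/
  Cf : ℝ
  /-- strength of short-range bonds inside the matrix phase -/
  Cm : ℝ
  /-- strength of short-range bonds between different phases -/
  Ci : ℝ
  /-- the part of the unit cell occupied by the inclusion phase -/
  inclusion : Set E3
  lam_pos : 0 < lam
  γ_pos : 0 < γ
  δ_pos : 0 < δ
  ρf_pos : 0 < ρf
  ρm_pos : 0 < ρm
  Cf_pos : 0 < Cf
  Cm_pos : 0 < Cm
  Ci_pos : 0 < Ci
  inclusion_subset : inclusion ⊆ unitCell
  inclusion_measurable : MeasurableSet inclusion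

namespace Medium

variable (M : Medium)

/-- Periodically extended indicator function of the inclusion phase. -/
def χf (y : E3) : ℝ := M.inclusion.indicator (fun _ => (1 : ℝ)) (cellRep y)

/-- Periodically extended indicator function of the matrix phase. -/
def χm (y : E3) : ℝ := 1 - M.χf y

/-- The periodic density. -/
def ρ (y : E3) : ℝ := M.χf y * M.ρf + M.χm y * M.ρm

/-- The periodic strength of the short-range bond between `y` and `y'`
(without the cut-off at the horizon). -/
def α (y y' : E3) : ℝ :=
  M.Cf * (M.χf y * M.χf y') + M.Cm * (M.χm y * M.χm y') +
    M.Ci * (M.χf y * M.χm y' + M.χm y * M.χf y')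

end Medium

/-- The space `L^p(Ω)³`. -/
abbrev LpVec (Ω : Set E3) (p : ℝ≥0∞) := Lp E3 p (volume.restrict Ω)

/-- The space `L^p_per(Y; C(Ω̄)³)`. Its elements are stored as Bochner `L^p` functions on the cell;
`perVal` evaluates their periodic extensions. For bounded `Ω` the closure is compact,
so that `closure Ω →ᵇ E3` is the space of all continuous vector fields on it, with the sup norm. -/
abbrev TwoScale (Ω : Set E3) (p : ℝ≥0∞) :=
  Lp (closure Ω →ᵇ E3) p (volume.restrict unitCell)

open Classical in
/-- The value `w(x, y)` of the `Y`-periodic extension of `w`, for `x` in the closure of `Ω`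
(and `0` for the remaining `x`). -/
def perVal {Ω : Set E3} {p : ℝ≥0∞} (w : TwoScale Ω p) (x y : E3) : E3 :=
  if h : x ∈ closure Ω then w (cellRep y) ⟨x, h⟩ else 0

/-- `u` is a classical solution, in `C²([0,T]; L^p(Ω)³)`, of the heterogeneous peridynamic
initial value problem at scale `ε`, with data `u₀(x, x/ε)`, `v₀(x, x/ε)`, `b(x, x/ε, t)`. -/
structure IsPeridynamicSolution (M : Medium) (Ω : Set E3) (p : ℝ≥0∞) [Fact (1 ≤ p)] (T : ℝ)
    (u₀ v₀ : TwoScale Ω p) (b : ℝ → TwoScale Ω p) (ε : ℝ) (u : ℝ → LpVec Ω p) : Prop where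
  contDiffOn : ContDiffOn ℝ 2 u (Icc 0 T)
  equation : ∀ t ∈ Icc 0 T, ∀ᵐ x ∂(volume.restrict Ω),
    M.ρ (ε⁻¹ • x) • iteratedDerivWithin 2 u (Icc 0 T) t x =
      (∫ x' in Metric.closedBall x M.γ ∩ Ω, M.lam • bond (x' - x) (u t x' - u t x)) +
      (∫ x' in Metric.ball x (ε * M.δ) ∩ Ω,
        ((1 / ε ^ 2) * M.α (ε⁻¹ • x) (ε⁻¹ • x')) • bond (x' - x) (u t x' - u t x)) +
      perVal (b t) x (ε⁻¹ • x)
  initial : ∀ᵐ x ∂(volume.restrict Ω), u 0 x = perVal u₀ x (ε⁻¹ • x)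
  initial_deriv : ∀ᵐ x ∂(volume.restrict Ω),
    derivWithin u (Icc 0 T) 0 x = perVal v₀ x (ε⁻¹ • x)

/-- `u` is a classical solution, in `C²([0,T]; L^p_per(Y; C(Ω̄)³))`, of the two-scale peridynamic
initial value problem. -/
structure IsTwoScaleSolution (M : Medium) (Ω : Set E3) (p : ℝ≥0∞) [Fact (1 ≤ p)] (T : ℝ)
    (u₀ v₀ : TwoScale Ω p) (b : ℝ → TwoScale Ω p) (u : ℝ → TwoScale Ω p) : Prop where
  contDiffOn : ContDiffOn ℝ 2 u (Icc 0 T)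
  equation : ∀ t ∈ Icc 0 T, ∀ᵐ y ∂(volume.restrict unitCell), ∀ x ∈ Ω,
    M.ρ y • perVal (iteratedDerivWithin 2 u (Icc 0 T) t) x y =
      (∫ x' in Metric.closedBall x M.γ ∩ Ω,
        M.lam • bond (x' - x) ((∫ y' in unitCell, perVal (u t) x' y') - perVal (u t) x y)) +
      (∫ y' in Metric.ball y M.δ,
        M.α y y' • bond (y' - y) (perVal (u t) x y' - perVal (u t) x y)) +
      perVal (b t) x y
  initial : u 0 = u₀
  initial_deriv : derivWithin u (Icc 0 T) 0 = v₀

end Peridynamics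

end

open Peridynamics

/-! Write `S w` for the trace x ↦ w(x, x/ε), `A` for the heterogeneous bond operator divided by the
density, and `B` for the two-scale operator divided by the density and read at y = x/ε. The loads
agree after evaluation at y = x/ε, so the error e = uε - S u satisfies e'' = A e + (A S - B) u(t)
with e(0) = e'(0) = 0. Grönwall's inequality (`norm_error_le`) reduces the theorem to two facts: `A`
is bounded uniformly in ε, and the consistency error (A S - B) u(t) tends to zero in L^p, uniformly
in t.

Uniform boundedness comes from scaling. A bond is at most 1/|z| times the displacement, and in three
dimensions the integral of 1/|z| over a ball of radius εδ is of order ε², which cancels the factor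
1/ε² (`exists_isBondKernel`). Minkowski's integral inequality turns kernel mass into an operator
norm (`IsBondKernel.bondInt_Lp`). The trace `S` is bounded because w is dominated by its sup norm in
x, a periodic function of y alone (`exists_bound_eLpNorm_perVal`).

For consistency, the trajectory u([0,T]) is compact and the operators are equibounded, so
convergence at each fixed w is enough (`eventually_norm_le_of_isCompact`), and by density only w =
1_s(y) c(x) with c continuous has to be treated. The long-range error is then an integrable field
tested against the oscillation 1_s(x'/ε) - mean, which converges weakly to zero
(`tendsto_integral_periodic_smul`). In the short-range error the oscillating parts cancel up to the
increment c(x+z) - c(x) over |z| < εδ, which is small by continuity; since Ω is open, such bonds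
eventually stay inside it. Bounded convergence turns these pointwise limits into limits in L^p
(`tendsto_eLpNorm_defect`). -/

namespace Peridynamics

/-! ### Periodicity and Lebesgue measure on the unit cell -/

section Cell

lemma cellRep_apply (y : E3) (i : Fin 3) :
    cellRep y i = Int.fract (y i + 1 / 2) - 1 / 2 := rfl

lemma cellRep_mem (y : E3) : cellRep y ∈ unitCell := by
  intro i
  rw [cellRep_apply]
  constructor
  · linarith [Int.fract_nonneg (y i + 1 / 2)]
  · linarith [Int.fract_lt_one (y i + 1 / 2)]

lemma cellRep_of_mem {y : E3} (hy : y ∈ unitCell) : cellRep y = y := by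
  ext i
  rw [cellRep_apply, Int.fract_eq_self.2]
  · ring
  · constructor <;> linarith [(hy i).1, (hy i).2]

lemma cellRep_cellRep_add (y z : E3) : cellRep (cellRep y + z) = cellRep (y + z) := by
  ext i
  simp only [cellRep_apply, PiLp.add_apply]
  congr 1
  have : Int.fract (y i + 1 / 2) - 1 / 2 + z i + 1 / 2
      = (y i + z i + 1 / 2) - (⌊y i + 1 / 2⌋ : ℤ) := by
    rw [Int.fract]; ring
  rw [this, Int.fract_sub_intCast]

lemma cellRep_cellRep (y : E3) : cellRep (cellRep y) = cellRep y :=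
  cellRep_of_mem (cellRep_mem y)

@[fun_prop]
lemma measurable_cellRep : Measurable cellRep := by
  unfold cellRep
  refine (MeasurableEquiv.toLp 2 (Fin 3 → ℝ)).measurable.comp ?_
  refine measurable_pi_lambda _ fun i => ?_
  have : Measurable fun y : E3 => y i := by fun_prop
  fun_prop

lemma measurableSet_unitCell : MeasurableSet unitCell := by
  have : unitCell = ⋂ i, {y : E3 | -(1 / 2 : ℝ) ≤ y i} ∩ {y : E3 | y i < 1 / 2} := by
    ext y; simp [unitCell]
  rw [this]
  refine MeasurableSet.iInter fun i => ?_
  have : Measurable fun y : E3 => y i := by fun_prop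
  exact (measurableSet_le measurable_const this).inter (measurableSet_lt this measurable_const)

lemma norm_le_one_of_mem_unitCell {y : E3} (hy : y ∈ unitCell) : ‖y‖ ≤ 1 := by
  have h2 : ‖y‖ ^ 2 ≤ 1 := by
    rw [EuclideanSpace.norm_sq_eq]
    have : ∀ i ∈ Finset.univ, ‖y i‖ ^ 2 ≤ (1 / 4 : ℝ) := fun i _ => by
      rw [Real.norm_eq_abs, sq_abs]
      nlinarith [(hy i).1, (hy i).2]
    refine (Finset.sum_le_sum this).trans ?_
    norm_num
  nlinarith [norm_nonneg y]

/-- The standard basis of `E3`. -/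
noncomputable def stdBasis : Module.Basis (Fin 3) ℝ E3 := (EuclideanSpace.basisFun (Fin 3) ℝ).toBasis

lemma stdBasis_repr (y : E3) (i : Fin 3) : stdBasis.repr y i = y i := by
  simp [stdBasis]

open Pointwise in
-- The centred cell is the standard fundamental domain of ℤ³ moved by half a unit in each
-- coordinate, so the theory of fundamental domains applies to all its translates.
lemma vadd_unitCell (a : E3) :
    a +ᵥ unitCell = (a - WithLp.toLp 2 (fun _ => (1 / 2 : ℝ))) +ᵥ ZSpan.fundamentalDomain stdBasis := by
  ext y
  rw [mem_vadd_set_iff_neg_vadd_mem, mem_vadd_set_iff_neg_vadd_mem, ZSpan.mem_fundamentalDomain]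
  simp only [stdBasis_repr, unitCell, mem_ofPred_eq, vadd_eq_add, mem_Ico]
  refine forall_congr' fun i => ?_
  simp only [PiLp.add_apply, PiLp.neg_apply, PiLp.sub_apply]
  constructor <;> rintro ⟨h1, h2⟩ <;> constructor <;> linarith

open Pointwise in
lemma isAddFundamentalDomain_vadd_unitCell (a : E3) :
    IsAddFundamentalDomain (Submodule.span ℤ (range stdBasis)) (a +ᵥ unitCell) volume := by
  rw [vadd_unitCell]
  exact (ZSpan.isAddFundamentalDomain stdBasis volume).vadd_of_comm _

instance vaddInvariantMeasure_span :
    VAddInvariantMeasure (Submodule.span ℤ (range stdBasis)) E3 volume :=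
  ⟨fun g s _ => measure_preimage_add volume (g : E3) s⟩

lemma cellRep_vadd (g : Submodule.span ℤ (range stdBasis)) (x : E3) :
    cellRep (g +ᵥ x) = cellRep x := by
  have hg := (stdBasis.mem_span_iff_repr_mem ℤ (g : E3)).1 g.2
  ext i
  obtain ⟨n, hn⟩ := hg i
  rw [stdBasis_repr] at hn
  have : (g +ᵥ x : E3) = (g : E3) + x := rfl
  simp only [cellRep_apply, this, PiLp.add_apply, ← hn]
  congr 1
  have : (algebraMap ℤ ℝ n : ℝ) + x i + 1 / 2 = (x i + 1 / 2) + (n : ℤ) := by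
    simp; ring
  rw [this, Int.fract_add_intCast]

/-- A lattice-invariant function has the same integral over any two fundamental domains, here the
cell and its translate by `a`. -/
lemma lintegral_unitCell_cellRep_add (G : E3 → ℝ≥0∞) (a : E3) :
    ∫⁻ y in unitCell, G (cellRep (a + y)) = ∫⁻ y in unitCell, G y := by
  open Pointwise in
  have h1 : ∫⁻ y in a +ᵥ unitCell, G (cellRep y) = ∫⁻ y in (0 : E3) +ᵥ unitCell, G (cellRep y) :=
    (isAddFundamentalDomain_vadd_unitCell a).setLIntegral_eq
      (isAddFundamentalDomain_vadd_unitCell 0) _ fun g x => by rw [cellRep_vadd]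
  rw [zero_vadd] at h1
  have h2 : ∫⁻ y in unitCell, G (cellRep y) = ∫⁻ y in unitCell, G y :=
    setLIntegral_congr_fun measurableSet_unitCell fun y hy => by
      simp only [cellRep_of_mem hy]
  have h3 : ∫⁻ y in unitCell, G (cellRep (a + y)) = ∫⁻ y in a +ᵥ unitCell, G (cellRep y) := by
    have := (measurePreserving_add_left volume a).setLIntegral_comp_emb
      (measurableEmbedding_addLeft a) (fun y => G (cellRep y)) unitCell
    rw [this]
    rfl
  rw [h3, h1, h2]

lemma measurePreserving_cellRep_add (a : E3) :
    MeasurePreserving (fun y => cellRep (a + y)) (volume.restrict unitCell)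
      (volume.restrict unitCell) := by
  have hm : Measurable fun y => cellRep (a + y) := by fun_prop
  refine ⟨hm, Measure.ext fun s hs => ?_⟩
  have := lintegral_unitCell_cellRep_add (s.indicator 1) a
  rw [lintegral_indicator_one hs] at this
  rw [Measure.map_apply hm hs, ← this, ← lintegral_indicator_one (hm hs)]
  rfl

lemma volume_unitCell : volume unitCell = 1 := by
  open Pointwise in
  have h := (isAddFundamentalDomain_vadd_unitCell 0).measure_eq
    (ZSpan.isAddFundamentalDomain stdBasis volume)
  rw [show (0 : E3) +ᵥ unitCell = unitCell from zero_vadd _ _] at h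
  rw [h, ZSpan.fundamentalDomain_ae_parallelepiped stdBasis volume |> measure_congr]
  have := (EuclideanSpace.basisFun (Fin 3) ℝ).volume_parallelepiped
  simpa [stdBasis] using this

instance isProbabilityMeasure_unitCell : IsProbabilityMeasure (volume.restrict unitCell) :=
  ⟨by rw [Measure.restrict_apply_univ, volume_unitCell]⟩

/-- Rescaled periodic functions are integrable over bounded sets, uniformly in the scale. -/
lemma setLIntegral_periodic_le {Ω : Set E3} {R : ℝ} (hΩ : Ω ⊆ Metric.closedBall 0 R)
    {G : E3 → ℝ≥0∞} (hG : Measurable G) {ε : ℝ} (hε : 0 < ε) (hε1 : ε ≤ 1) (z : E3) :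
    ∫⁻ x in Ω, G (cellRep (ε⁻¹ • (x + z))) ≤
      volume (Metric.closedBall (0 : E3) (R + 1)) * ∫⁻ y in unitCell, G y := by
  set F : E3 → ℝ≥0∞ := fun x => G (cellRep (ε⁻¹ • (x + z))) with hF
  have hFm : Measurable F := by fun_prop
  -- Moving x by ε y with y in the cell enlarges the ball by at most 1, as ε ≤ 1 and ‖y‖ ≤ 1.
  -- Averaging over y and exchanging the integrals then replaces `G` by its cell integral.
  have key : ∀ y ∈ unitCell, ∫⁻ x in Ω, F x ≤
      ∫⁻ x in Metric.closedBall (0 : E3) (R + 1), G (cellRep (ε⁻¹ • (x + z) + y)) := by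
    intro y hy
    calc ∫⁻ x in Ω, F x ≤ ∫⁻ x in Metric.closedBall (0 : E3) R, F x := lintegral_mono_set hΩ
      _ = ∫⁻ x, (Metric.closedBall (0 : E3) R).indicator F x :=
        (lintegral_indicator measurableSet_closedBall _).symm
      _ = ∫⁻ x, (Metric.closedBall (0 : E3) R).indicator F (x + ε • y) :=
        (lintegral_add_right_eq_self _ _).symm
      _ ≤ ∫⁻ x, (Metric.closedBall (0 : E3) (R + 1)).indicator
            (fun x => G (cellRep (ε⁻¹ • (x + z) + y))) x := by
        refine lintegral_mono fun x => ?_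
        by_cases hx : x + ε • y ∈ Metric.closedBall (0 : E3) R
        · have hx' : x ∈ Metric.closedBall (0 : E3) (R + 1) := by
            rw [mem_closedBall_zero_iff] at hx ⊢
            have h1 : ‖x‖ ≤ ‖x + ε • y‖ + ‖ε • y‖ := by
              simpa using norm_sub_le (x + ε • y) (ε • y)
            have h2 : ‖ε • y‖ ≤ 1 := by
              rw [norm_smul, Real.norm_of_nonneg hε.le]
              nlinarith [norm_le_one_of_mem_unitCell hy, norm_nonneg y]
            linarith
          rw [indicator_of_mem hx, indicator_of_mem hx']
          have : ε⁻¹ • (x + ε • y + z) = ε⁻¹ • (x + z) + y := by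
            rw [add_right_comm, smul_add _ (x + z), inv_smul_smul₀ hε.ne']
          simp only [hF, this, le_refl]
        · rw [indicator_of_notMem hx]
          exact zero_le
      _ = _ := lintegral_indicator measurableSet_closedBall _
  have hprob : ∫⁻ x in Ω, F x = ∫⁻ _ in unitCell, (∫⁻ x in Ω, F x) := by
    rw [lintegral_const, measure_univ, mul_one]
  rw [hprob]
  calc ∫⁻ _ in unitCell, (∫⁻ x in Ω, F x)
      ≤ ∫⁻ y in unitCell, ∫⁻ x in Metric.closedBall (0 : E3) (R + 1),
          G (cellRep (ε⁻¹ • (x + z) + y)) :=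
        setLIntegral_mono' measurableSet_unitCell key
    _ = ∫⁻ x in Metric.closedBall (0 : E3) (R + 1), ∫⁻ y in unitCell,
          G (cellRep (ε⁻¹ • (x + z) + y)) := by
        refine lintegral_lintegral_swap (Measurable.aemeasurable ?_)
        simp only [Function.uncurry_def]
        fun_prop
    _ = _ := by
        simp only [lintegral_unitCell_cellRep_add]
        rw [lintegral_const, Measure.restrict_apply_univ, mul_comm]

/-- The periodic estimate, applied to the indicator of a null set of the cell, shows that its
rescaled copies are null in every ball. -/
lemma quasiMeasurePreserving_cellRep {ε : ℝ} (hε : 0 < ε) (hε1 : ε ≤ 1) :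
    Measure.QuasiMeasurePreserving (fun x => cellRep (ε⁻¹ • x)) volume
      (volume.restrict unitCell) := by
  have hm : Measurable fun x : E3 => cellRep (ε⁻¹ • x) := by fun_prop
  refine ⟨hm, Measure.AbsolutelyContinuous.mk fun s hs h0 => ?_⟩
  rw [Measure.map_apply hm hs]
  have hn : ∀ n : ℕ, volume ((fun x => cellRep (ε⁻¹ • x)) ⁻¹' s ∩ Metric.closedBall 0 n) = 0 := by
    intro n
    have := setLIntegral_periodic_le (Subset.refl (Metric.closedBall (0 : E3) (n : ℝ)))
      (G := s.indicator 1) (measurable_one.indicator hs) hε hε1 0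
    rw [lintegral_indicator_one hs, h0, mul_zero] at this
    rw [← Measure.restrict_apply (hm hs), ← lintegral_indicator_one (hm hs)]
    simp only [add_zero] at this
    exact le_antisymm this zero_le
  rw [← inter_univ (_ ⁻¹' s), ← Metric.iUnion_closedBall_nat (0 : E3), inter_iUnion]
  exact measure_iUnion_null hn

lemma ae_cellRep {P : E3 → Prop} (h : ∀ᵐ y ∂(volume.restrict unitCell), P y) {ε : ℝ} (hε : 0 < ε)
    (hε1 : ε ≤ 1) : ∀ᵐ x : E3, P (cellRep (ε⁻¹ • x)) :=
  (quasiMeasurePreserving_cellRep hε hε1).ae h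

/-- The map is a measure-preserving shear followed by a projection. It is needed because
representatives are controlled at x + z only for almost every pair. -/
lemma quasiMeasurePreserving_add_prod :
    Measure.QuasiMeasurePreserving (fun q : E3 × E3 => q.1 + q.2) (volume.prod volume) volume :=
  Measure.quasiMeasurePreserving_snd.comp
    (measurePreserving_prod_add (volume : Measure E3) (volume : Measure E3)).quasiMeasurePreserving

/-- A property that holds almost everywhere holds at `x + z` for almost all `x`, `z`. -/
lemma ae_ae_add {P : E3 → Prop} (h : ∀ᵐ y : E3, P y) : ∀ᵐ x : E3, ∀ᵐ z : E3, P (x + z) :=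
  Measure.ae_ae_of_ae_prod (quasiMeasurePreserving_add_prod.ae h)

end Cell

end Peridynamics

namespace Peridynamics

/-! ### Weak convergence of rapidly oscillating functions -/

section WeakConvergence

/-- Translations act continuously on L¹; this is the continuity of that action at zero, written with
integrals. -/
lemma tendsto_integral_norm_translate_sub {g : E3 → E3} (hg : Integrable g) :
    Tendsto (fun c : E3 => ∫ x, ‖g (x + c) - g x‖) (𝓝 0) (𝓝 0) := by
  have hL : MemLp g 1 volume := memLp_one_iff_integrable.2 hg
  have : Fact ((1 : ℝ≥0∞) ≠ ∞) := ⟨ENNReal.one_ne_top⟩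
  have hcont : Continuous fun c : E3 => (DomAddAct.mk c) +ᵥ hL.toLp g :=
    (DomAddAct.continuous_mk).vadd continuous_const
  have h0 : Tendsto (fun c : E3 => ‖(DomAddAct.mk c +ᵥ hL.toLp g) - hL.toLp g‖) (𝓝 0) (𝓝 0) := by
    have : Continuous fun c : E3 => ‖(DomAddAct.mk c +ᵥ hL.toLp g) - hL.toLp g‖ :=
      (hcont.sub continuous_const).norm
    have h := this.tendsto 0
    simpa using h
  refine h0.congr fun c => ?_
  rw [DomAddAct.mk_vadd_toLp, ← MemLp.toLp_sub, L1.norm_eq_integral_norm]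
  refine integral_congr_ae ?_
  filter_upwards [MemLp.coeFn_toLp ((hL.comp_measurePreserving
    (measurePreserving_vadd c volume)).sub hL)] with x hx
  refine (congrArg norm hx).trans ?_
  simp [add_comm]

lemma integral_unitCell_cellRep_add {h : E3 → ℝ} (hm : Measurable h) (a : E3) :
    ∫ y in unitCell, h (cellRep (a + y)) = ∫ y in unitCell, h y := by
  have := measurePreserving_cellRep_add a
  conv_rhs => rw [← this.map_eq]
  rw [integral_map this.measurable.aemeasurable hm.aestronglyMeasurable]

/-- Rescaled bounded periodic functions of mean zero converge to zero, tested
against integrable functions. -/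
lemma tendsto_integral_periodic_smul {h : E3 → ℝ} (hm : Measurable h) {B : ℝ} (hB : ∀ y, |h y| ≤ B)
    (h0 : ∫ y in unitCell, h y = 0) {g : E3 → E3} (hg : Integrable g) :
    Tendsto (fun ε : ℝ => ∫ x, h (cellRep (ε⁻¹ • x)) • g x) (𝓝[>] 0) (𝓝 0) := by
  have hB0 : 0 ≤ B := (abs_nonneg _).trans (hB 0)
  rw [Metric.tendsto_nhds]
  intro η hη
  have hη' : 0 < η / (B + 1) := by positivity
  obtain ⟨r, hr, hr'⟩ := Metric.eventually_nhds_iff.1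
    ((Metric.tendsto_nhds.1 (tendsto_integral_norm_translate_sub hg)) _ hη')
  filter_upwards [self_mem_nhdsWithin, mem_nhdsWithin_of_mem_nhds (Iio_mem_nhds hr)] with ε hε hεr
  rw [mem_Ioi] at hε
  rw [mem_Iio] at hεr
  rw [dist_zero_right]
  set I := ∫ x, h (cellRep (ε⁻¹ • x)) • g x with hI
  have hint : ∀ (y : E3) {f : E3 → E3}, Integrable f →
      Integrable fun x => h (cellRep (ε⁻¹ • x + y)) • f x := fun y f hf =>
    hf.bdd_smul B (by fun_prop : Measurable fun x => h (cellRep (ε⁻¹ • x + y))).aestronglyMeasurable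
      (Eventually.of_forall fun x => hB _)
  -- A phase shift by y amounts to translating `g` by ε y, which changes the integral little.
  -- Averaged over all phases the integral is zero, by Fubini and the mean-zero hypothesis, so `I`
  -- itself is small.
  set J : E3 → E3 := fun y => ∫ x, h (cellRep (ε⁻¹ • x + y)) • g x with hJ
  have hIJ : ∀ y ∈ unitCell, ‖I - J y‖ ≤ B * (η / (B + 1)) := by
    intro y hy
    have hshift : I = ∫ x, h (cellRep (ε⁻¹ • x + y)) • g (x + ε • y) := by
      rw [hI, ← integral_add_right_eq_self _ (ε • y)]
      simp only [smul_add, inv_smul_smul₀ hε.ne']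
    have hg' := hg.comp_add_right (ε • y)
    rw [hshift, ← integral_sub (hint y hg') (hint y hg)]
    have hd := hr' (y := ε • y) (by
      rw [dist_zero_right, norm_smul, Real.norm_of_nonneg hε.le]
      nlinarith [norm_le_one_of_mem_unitCell hy, norm_nonneg y])
    rw [dist_zero_right, Real.norm_of_nonneg (integral_nonneg fun _ => norm_nonneg _)] at hd
    calc ‖∫ x, (h (cellRep (ε⁻¹ • x + y)) • g (x + ε • y) - h (cellRep (ε⁻¹ • x + y)) • g x)‖
        ≤ ∫ x, B * ‖g (x + ε • y) - g x‖ := by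
          refine norm_integral_le_of_norm_le ((hg'.sub hg).norm.const_mul B)
            (Eventually.of_forall fun x => ?_)
          rw [← smul_sub, norm_smul]
          exact mul_le_mul_of_nonneg_right (hB _) (norm_nonneg _)
      _ = B * ∫ x, ‖g (x + ε • y) - g x‖ := integral_const_mul _ _
      _ ≤ _ := mul_le_mul_of_nonneg_left hd.le hB0
  have hprod : Integrable (Function.uncurry fun (y x : E3) => h (cellRep (ε⁻¹ • x + y)) • g x)
      ((volume.restrict unitCell).prod volume) := by
    have h1 : Integrable (fun q : E3 × E3 => g q.2) ((volume.restrict unitCell).prod volume) :=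
      hg.comp_snd _
    refine h1.bdd_smul (φ := fun q : E3 × E3 => h (cellRep (ε⁻¹ • q.2 + q.1))) B
      (by fun_prop : Measurable fun q : E3 × E3 =>
        h (cellRep (ε⁻¹ • q.2 + q.1))).aestronglyMeasurable (Eventually.of_forall fun x => hB _)
  have hJ0 : ∫ y in unitCell, J y = 0 := by
    rw [integral_integral_swap hprod]
    simp_rw [integral_smul_const, integral_unitCell_cellRep_add hm, h0, zero_smul]
    exact integral_zero _ _
  have hJi : Integrable J (volume.restrict unitCell) := hprod.integral_prod_left
  have hfin : I = ∫ y in unitCell, (I - J y) := by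
    rw [integral_sub (integrable_const _) hJi, hJ0, sub_zero, integral_const]
    simp
  rw [hfin]
  calc ‖∫ y in unitCell, (I - J y)‖ ≤ B * (η / (B + 1)) * (volume.restrict unitCell).real univ :=
        norm_integral_le_of_norm_le_const (by
          filter_upwards [ae_restrict_mem measurableSet_unitCell] with y hy using hIJ y hy)
    _ = B * (η / (B + 1)) := by simp
    _ < η := by
        rw [mul_div_assoc', div_lt_iff₀ (by positivity)]
        nlinarith

end WeakConvergence

/-! ### Evaluation of two-scale fields -/

section PerVal

variable {Ω : Set E3} {p : ℝ≥0∞}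

lemma perVal_cellRep_add (w : TwoScale Ω p) (x y z : E3) :
    perVal w x (cellRep y + z) = perVal w x (y + z) := by
  unfold perVal; rw [cellRep_cellRep_add]

lemma perVal_cellRep (w : TwoScale Ω p) (x y : E3) : perVal w x (cellRep y) = perVal w x y := by
  unfold perVal; rw [cellRep_cellRep]

lemma norm_perVal_le (w : TwoScale Ω p) (x y : E3) : ‖perVal w x y‖ ≤ ‖w (cellRep y)‖ := by
  unfold perVal
  split_ifs with h
  · exact (w (cellRep y)).norm_coe_le_norm _
  · simp

/-- Evaluation (f, x) ↦ f x is jointly continuous, and it is composed with a strongly measurable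
map. Strong measurability allows pairing without second countability of the function space. -/
lemma measurable_perVal (w : TwoScale Ω p) :
    Measurable fun q : E3 × E3 => perVal w q.1 q.2 := by
  classical
  have hs : MeasurableSet {q : E3 × E3 | q.1 ∈ closure Ω} :=
    isClosed_closure.measurableSet.preimage measurable_fst
  have h1 : StronglyMeasurable fun q : {q : E3 × E3 | q.1 ∈ closure Ω} =>
      (w (cellRep q.1.2)) ⟨q.1.1, q.2⟩ := by
    have ha : StronglyMeasurable fun q : {q : E3 × E3 | q.1 ∈ closure Ω} => w (cellRep q.1.2) :=
      (Lp.stronglyMeasurable w).comp_measurable (by fun_prop)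
    have hb : StronglyMeasurable fun q : {q : E3 × E3 | q.1 ∈ closure Ω} =>
        (⟨q.1.1, q.2⟩ : closure Ω) := by
      refine Measurable.stronglyMeasurable ?_
      exact Measurable.subtype_mk (by fun_prop)
    have hev : Continuous fun r : (closure Ω →ᵇ E3) × closure Ω => r.1 r.2 := by fun_prop
    exact hev.comp_stronglyMeasurable (ha.prodMk hb)
  unfold perVal
  exact Measurable.dite (s := {q : E3 × E3 | q.1 ∈ closure Ω})
    (f := fun q => (w (cellRep q.1.2)) ⟨q.1.1, q.2⟩) (g := fun _ => 0) h1.measurable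
    measurable_const hs

/-- The exceptional set of y does not depend on x, because the values at y are whole functions of x.
This is what makes the diagonal y = x/ε accessible. -/
lemma perVal_add (w w' : TwoScale Ω p) :
    ∀ᵐ y ∂(volume.restrict unitCell), ∀ x,
      perVal (w + w') x y = perVal w x y + perVal w' x y := by
  filter_upwards [Lp.coeFn_add w w', ae_restrict_mem measurableSet_unitCell] with y hy hy' x
  unfold perVal
  rw [cellRep_of_mem hy', hy]
  split_ifs <;> simp

lemma perVal_smul (c : ℝ) (w : TwoScale Ω p) :
    ∀ᵐ y ∂(volume.restrict unitCell), ∀ x, perVal (c • w) x y = c • perVal w x y := by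
  filter_upwards [Lp.coeFn_smul c w, ae_restrict_mem measurableSet_unitCell] with y hy hy' x
  unfold perVal
  rw [cellRep_of_mem hy', hy]
  split_ifs <;> simp

/-- Almost everywhere statements on the cell transfer to rescaled points. -/
lemma ae_scaled {P : E3 → Prop} (h : ∀ᵐ y ∂(volume.restrict unitCell), P y)
    (hP : ∀ y, P (cellRep y) → P y) {ε : ℝ} (hε : 0 < ε) (hε1 : ε ≤ 1) :
    ∀ᵐ x : E3, P (ε⁻¹ • x) :=
  (ae_cellRep h hε hε1).mono fun _ => hP _

lemma perVal_add_scaled (w w' : TwoScale Ω p) {ε : ℝ} (hε : 0 < ε) (hε1 : ε ≤ 1) :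
    ∀ᵐ s : E3, ∀ x, perVal (w + w') x (ε⁻¹ • s) = perVal w x (ε⁻¹ • s) + perVal w' x (ε⁻¹ • s) :=
  ae_scaled (P := fun y => ∀ x, perVal (w + w') x y = perVal w x y + perVal w' x y)
    (perVal_add w w') (fun y h x => by simpa only [perVal_cellRep] using h x) hε hε1

lemma perVal_smul_scaled (c : ℝ) (w : TwoScale Ω p) {ε : ℝ} (hε : 0 < ε) (hε1 : ε ≤ 1) :
    ∀ᵐ s : E3, ∀ x, perVal (c • w) x (ε⁻¹ • s) = c • perVal w x (ε⁻¹ • s) :=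
  ae_scaled (P := fun y => ∀ x, perVal (c • w) x y = c • perVal w x y)
    (perVal_smul c w) (fun y h x => by simpa only [perVal_cellRep] using h x) hε hε1

/-- Taking the sup norm in the slow variable leaves a periodic function of the fast variable, to
which `setLIntegral_periodic_le` applies. The shift `z` serves the displacements. -/
lemma exists_bound_eLpNorm_perVal [Fact (1 ≤ p)] (hp : p ≠ ∞) (hΩ : Bornology.IsBounded Ω) :
    ∃ C : ℝ, 0 ≤ C ∧ ∀ (w : TwoScale Ω p) (ε : ℝ), 0 < ε → ε ≤ 1 → ∀ z : E3,
      eLpNorm (fun x => perVal w x (ε⁻¹ • (x + z))) p (volume.restrict Ω)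
        ≤ ENNReal.ofReal (C * ‖w‖) := by
  obtain ⟨R, hR⟩ := hΩ.subset_closedBall 0
  have hp0 : p ≠ 0 := (zero_lt_one.trans_le (Fact.out : 1 ≤ p)).ne'
  have hpr : 0 < p.toReal := ENNReal.toReal_pos hp0 hp
  have hV : volume (Metric.closedBall (0 : E3) (R + 1)) ≠ ∞ := measure_closedBall_lt_top.ne
  refine ⟨(volume (Metric.closedBall (0 : E3) (R + 1)) ^ (1 / p.toReal)).toReal,
    ENNReal.toReal_nonneg, fun w ε hε hε1 z => ?_⟩
  rw [ENNReal.ofReal_mul ENNReal.toReal_nonneg,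
    ENNReal.ofReal_toReal (ENNReal.rpow_ne_top_of_nonneg (by positivity) hV), Lp.norm_def,
    ENNReal.ofReal_toReal (Lp.eLpNorm_ne_top w), eLpNorm_eq_lintegral_rpow_enorm_toReal hp0 hp,
    eLpNorm_eq_lintegral_rpow_enorm_toReal hp0 hp, ← ENNReal.mul_rpow_of_nonneg _ _ (by positivity)]
  refine ENNReal.rpow_le_rpow ?_ (by positivity)
  have hm : Measurable fun y => ‖w y‖ₑ ^ p.toReal :=
    (Lp.stronglyMeasurable w).enorm.pow_const _
  refine le_trans (lintegral_mono fun x => ?_) (setLIntegral_periodic_le hR hm hε hε1 z)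
  refine ENNReal.rpow_le_rpow ?_ hpr.le
  exact enorm_le_iff_norm_le.2 (norm_perVal_le _ _ _)

end PerVal

end Peridynamics

namespace Peridynamics

/-! ### Bond integrals as bounded operators on L^p -/

section BondOperator

lemma norm_bond_le (ξ η : E3) : ‖bond ξ η‖ ≤ ‖ξ‖⁻¹ * ‖η‖ := by
  rcases eq_or_ne ξ 0 with rfl | hξ
  · simp [bond]
  have h : 0 < ‖ξ‖ := norm_pos_iff.2 hξ
  rw [bond, norm_smul, norm_div, norm_pow, norm_norm]
  calc ‖(inner ℝ ξ η : ℝ)‖ / ‖ξ‖ ^ 3 * ‖ξ‖ ≤ (‖ξ‖ * ‖η‖) / ‖ξ‖ ^ 3 * ‖ξ‖ := by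
        gcongr; exact norm_inner_le_norm ξ η
    _ = ‖ξ‖⁻¹ * ‖η‖ := by field_simp

lemma bond_add (ξ η η' : E3) : bond ξ (η + η') = bond ξ η + bond ξ η' := by
  simp [bond, inner_add_right, add_div, add_smul]

lemma bond_smul (c : ℝ) (ξ η : E3) : bond ξ (c • η) = c • bond ξ η := by
  simp [bond, inner_smul_right, mul_div_assoc, mul_smul]

lemma bond_zero (ξ : E3) : bond ξ 0 = 0 := by simp [bond]

lemma bond_sub (ξ η η' : E3) : bond ξ (η - η') = bond ξ η - bond ξ η' := by
  simp [bond, inner_sub_right, sub_div, sub_smul]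

lemma measurable_bond : Measurable fun q : E3 × E3 => bond q.1 q.2 := by
  unfold bond
  fun_prop

/-- Integral form of Minkowski's inequality, for a finite weight. -/
lemma lintegral_rpow_lintegral_mul_le {α β : Type*} [MeasurableSpace α] [MeasurableSpace β]
    (μ : Measure α) (ν : Measure β) [SFinite μ] [SFinite ν] {κ : β → ℝ≥0∞} (hκ : Measurable κ)
    {F : α → β → ℝ≥0∞} (hF : Measurable (Function.uncurry F)) {q : ℝ} (hq : 1 ≤ q) {D : ℝ≥0∞}
    (hD : ∀ z, ∫⁻ x, F x z ^ q ∂μ ≤ D) :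
    ∫⁻ x, (∫⁻ z, κ z * F x z ∂ν) ^ q ∂μ ≤ (∫⁻ z, κ z ∂ν) ^ q * D := by
  set ν' := ν.withDensity κ with hν'
  have hq0 : 0 < q := zero_lt_one.trans_le hq
  have hmass : ν' univ = ∫⁻ z, κ z ∂ν := by
    rw [hν', withDensity_apply _ MeasurableSet.univ, Measure.restrict_univ]
  have hwd : ∀ G : β → ℝ≥0∞, Measurable G → ∫⁻ z, κ z * G z ∂ν = ∫⁻ z, G z ∂ν' := fun G hG => by
    rw [hν', lintegral_withDensity_eq_lintegral_mul _ hκ hG]; rfl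
  -- Jensen's inequality for the finite measure κ dν, in the form of the comparison of its L¹ and
  -- L^q norms.
  have hJ : ∀ x, (∫⁻ z, κ z * F x z ∂ν) ^ q
      ≤ (∫⁻ z, κ z * F x z ^ q ∂ν) * (∫⁻ z, κ z ∂ν) ^ (q - 1) := by
    intro x
    have hFx : Measurable (F x) := hF.of_uncurry_left
    have h := eLpNorm'_le_eLpNorm'_mul_rpow_measure_univ (μ := ν') (f := F x) zero_lt_one hq
      hFx.aestronglyMeasurable
    simp only [eLpNorm', enorm_eq_self, ENNReal.rpow_one, div_one, hmass] at h
    rw [hwd _ hFx, hwd _ (hFx.pow_const q)]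
    calc (∫⁻ z, F x z ∂ν') ^ q
        ≤ ((∫⁻ z, F x z ^ q ∂ν') ^ (1 / q) * (∫⁻ z, κ z ∂ν) ^ (1 - 1 / q)) ^ q :=
          ENNReal.rpow_le_rpow h hq0.le
      _ = _ := by
          rw [ENNReal.mul_rpow_of_nonneg _ _ hq0.le, ← ENNReal.rpow_mul, ← ENNReal.rpow_mul]
          congr 2
          · rw [one_div_mul_cancel hq0.ne', ENNReal.rpow_one]
          · field_simp
  calc ∫⁻ x, (∫⁻ z, κ z * F x z ∂ν) ^ q ∂μ
      ≤ ∫⁻ x, (∫⁻ z, κ z * F x z ^ q ∂ν) * (∫⁻ z, κ z ∂ν) ^ (q - 1) ∂μ := lintegral_mono hJ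
    _ = (∫⁻ x, ∫⁻ z, κ z * F x z ^ q ∂ν ∂μ) * (∫⁻ z, κ z ∂ν) ^ (q - 1) := by
        rw [lintegral_mul_const]
        exact ((hκ.comp measurable_snd).mul (hF.pow_const q)).lintegral_prod_right'
    _ = (∫⁻ z, κ z * ∫⁻ x, F x z ^ q ∂μ ∂ν) * (∫⁻ z, κ z ∂ν) ^ (q - 1) := by
        rw [lintegral_lintegral_swap]
        · congr 1
          refine lintegral_congr fun z => ?_
          rw [lintegral_const_mul]
          exact (hF.of_uncurry_right).pow_const q
        · exact ((hκ.comp measurable_snd).mul (hF.pow_const q)).aemeasurable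
    _ ≤ (∫⁻ z, κ z * D ∂ν) * (∫⁻ z, κ z ∂ν) ^ (q - 1) := by
        gcongr with z; exact hD z
    _ = (∫⁻ z, κ z ∂ν) ^ q * D := by
        rw [lintegral_mul_const _ hκ]
        have : (∫⁻ z, κ z ∂ν) ^ q = (∫⁻ z, κ z ∂ν) ^ (q - 1) * (∫⁻ z, κ z ∂ν) := by
          conv_lhs => rw [show q = (q - 1) + 1 by ring]
          rw [ENNReal.rpow_add_of_nonneg _ _ (by linarith) zero_le_one, ENNReal.rpow_one]
        rw [this]; ring

/-- The bond integral with kernel `k` of the field of relative displacements `Φ`. -/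
noncomputable def bondInt (k : E3 → E3 → ℝ) (Φ : E3 → E3 → E3) (x : E3) : E3 :=
  ∫ z, k x z • bond z (Φ x z)

/-- `k` is a measurable bond kernel, dominated by an integrable weight of mass at most `m`. -/
structure IsBondKernel (k : E3 → E3 → ℝ) (m : ℝ) : Prop where
  measurable : Measurable (Function.uncurry k)
  dominated : ∃ κ : E3 → ℝ, Measurable κ ∧ Integrable κ ∧ ∫ z, κ z ≤ m ∧
    ∀ x z, |k x z| * ‖z‖⁻¹ ≤ κ z

variable {k : E3 → E3 → ℝ} {m : ℝ} {p : ℝ≥0∞} {μ : Measure E3}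

lemma IsBondKernel.measurable_integrand (hk : IsBondKernel k m) {Φ : E3 → E3 → E3}
    (hΦ : Measurable (Function.uncurry Φ)) :
    Measurable (Function.uncurry fun x z => k x z • bond z (Φ x z)) := by
  have h2 : Measurable fun q : E3 × E3 => (q.2, Function.uncurry Φ q) := measurable_snd.prodMk hΦ
  have h := hk.measurable.smul (measurable_bond.comp h2)
  simp only [Function.comp_def, Function.uncurry_def] at h ⊢
  exact h

lemma IsBondKernel.measurable_bondInt (hk : IsBondKernel k m) {Φ : E3 → E3 → E3}
    (hΦ : Measurable (Function.uncurry Φ)) : Measurable (bondInt k Φ) :=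
  (StronglyMeasurable.integral_prod_right
    (hk.measurable_integrand hΦ).stronglyMeasurable).measurable

lemma norm_smul_bond_le {c : ℝ} {z η : E3} {κ : ℝ} (h : |c| * ‖z‖⁻¹ ≤ κ) :
    ‖c • bond z η‖ ≤ κ * ‖η‖ := by
  rw [norm_smul, Real.norm_eq_abs]
  calc |c| * ‖bond z η‖ ≤ |c| * (‖z‖⁻¹ * ‖η‖) := by gcongr; exact norm_bond_le _ _
    _ = |c| * ‖z‖⁻¹ * ‖η‖ := by ring
    _ ≤ _ := by gcongr

/-- The integrand is at most κ(z) ‖Φ(x, z)‖, so Minkowski's inequality needs only a bound on each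
slice in x. Finiteness of the resulting norm also gives integrability in z for almost every x. -/
lemma IsBondKernel.bondInt_Lp (hk : IsBondKernel k m) [SFinite μ] (hp1 : 1 ≤ p) (hp : p ≠ ∞)
    {Φ : E3 → E3 → E3} (hΦ : Measurable (Function.uncurry Φ)) {C : ℝ}
    (hC : ∀ z, eLpNorm (fun x => Φ x z) p μ ≤ ENNReal.ofReal C) :
    eLpNorm (bondInt k Φ) p μ ≤ ENNReal.ofReal (m * C) ∧
      ∀ᵐ x ∂μ, Integrable fun z => k x z • bond z (Φ x z) := by
  obtain ⟨κ, hκm, hκi, hκ, hkκ⟩ := hk.dominated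
  have hκ0 : ∀ z, 0 ≤ κ z := fun z => le_trans (by positivity) (hkκ 0 z)
  have hp0 : p ≠ 0 := (zero_lt_one.trans_le hp1).ne'
  have hq : 1 ≤ p.toReal := by
    rw [← ENNReal.toReal_one]; exact ENNReal.toReal_mono hp hp1
  have hq0 : 0 < p.toReal := zero_lt_one.trans_le hq
  have hm0 : 0 ≤ m := (integral_nonneg hκ0).trans hκ
  have hmass : ∫⁻ z, ENNReal.ofReal (κ z) ≤ ENNReal.ofReal m := by
    rw [← ofReal_integral_eq_lintegral_ofReal hκi (Eventually.of_forall hκ0)]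
    exact ENNReal.ofReal_le_ofReal hκ
  set F : E3 → E3 → ℝ≥0∞ := fun x z => ‖Φ x z‖ₑ with hFdef
  have hF : Measurable (Function.uncurry F) := hΦ.enorm
  have hκF : Measurable (Function.uncurry fun x z => ENNReal.ofReal (κ z) * F x z) :=
    (hκm.ennreal_ofReal.comp measurable_snd).mul hF
  have hmk := lintegral_rpow_lintegral_mul_le μ volume hκm.ennreal_ofReal hF hq
    (D := ENNReal.ofReal C ^ p.toReal) fun z => by
      have := hC z
      rw [eLpNorm_eq_lintegral_rpow_enorm_toReal hp0 hp] at this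
      exact (ENNReal.rpow_inv_le_iff hq0).1 (one_div p.toReal ▸ this)
  have hmk' : ∫⁻ x, (∫⁻ z, ENNReal.ofReal (κ z) * F x z) ^ p.toReal ∂μ
      ≤ ENNReal.ofReal (m * C) ^ p.toReal := by
    refine hmk.trans ?_
    rw [ENNReal.ofReal_mul hm0, ENNReal.mul_rpow_of_nonneg _ _ hq0.le]
    gcongr
  have hpt : ∀ x z, ‖k x z • bond z (Φ x z)‖ₑ ≤ ENNReal.ofReal (κ z) * F x z := fun x z => by
    simp only [hFdef]
    rw [← ofReal_norm, ← ofReal_norm, ← ENNReal.ofReal_mul (hκ0 z)]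
    exact ENNReal.ofReal_le_ofReal (norm_smul_bond_le (hkκ x z))
  constructor
  · rw [eLpNorm_eq_lintegral_rpow_enorm_toReal hp0 hp, one_div, ENNReal.rpow_inv_le_iff hq0]
    refine le_trans (lintegral_mono fun x => ENNReal.rpow_le_rpow ?_ hq0.le) hmk'
    exact (enorm_integral_le_lintegral_enorm _).trans (lintegral_mono (hpt x))
  · have hfin := ae_lt_top (μ := μ)
      (hκF.lintegral_prod_right'.pow_const p.toReal)
      (hmk'.trans_lt (ENNReal.rpow_lt_top_of_nonneg hq0.le ENNReal.ofReal_ne_top)).ne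
    filter_upwards [hfin] with x hx
    refine ⟨(hk.measurable_integrand hΦ).of_uncurry_left.aestronglyMeasurable, ?_⟩
    exact (lintegral_mono (hpt x)).trans_lt ((ENNReal.rpow_lt_top_iff_of_pos hq0).1 hx)

/-- Pointwise counterpart of the L^p bound. Displacements are controlled only on the support of the
kernel, so short bonds see only a neighbourhood of x. -/
lemma IsBondKernel.bondInt_bounded (hk : IsBondKernel k m)
    {Φ : E3 → E3 → E3} (hΦ : Measurable (Function.uncurry Φ)) {C : ℝ} (hC0 : 0 ≤ C) {x : E3}
    (hC : ∀ z, k x z ≠ 0 → ‖Φ x z‖ ≤ C) :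
    ‖bondInt k Φ x‖ ≤ m * C ∧ Integrable fun z => k x z • bond z (Φ x z) := by
  obtain ⟨κ, hκm, hκi, hκ, hkκ⟩ := hk.dominated
  have hκ0 : ∀ z, 0 ≤ κ z := fun z => le_trans (by positivity) (hkκ 0 z)
  have hb : ∀ z, ‖k x z • bond z (Φ x z)‖ ≤ κ z * C := fun z => by
    by_cases h : k x z = 0
    · rw [h, zero_smul, norm_zero]
      exact mul_nonneg (hκ0 z) hC0
    · exact (norm_smul_bond_le (hkκ x z)).trans (mul_le_mul_of_nonneg_left (hC z h) (hκ0 z))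
  have hi : Integrable fun z => κ z * C := hκi.mul_const C
  refine ⟨?_, hi.mono' (hk.measurable_integrand hΦ).of_uncurry_left.aestronglyMeasurable
    (Eventually.of_forall hb)⟩
  calc ‖bondInt k Φ x‖ ≤ ∫ z, κ z * C := norm_integral_le_of_norm_le hi (Eventually.of_forall hb)
    _ = (∫ z, κ z) * C := integral_mul_const _ _
    _ ≤ m * C := mul_le_mul_of_nonneg_right hκ hC0

/-- A bounded operator into `L^p` from an almost everywhere linear assignment of functions. -/
lemma exists_clm_of_ae {X : Type*} [NormedAddCommGroup X] [NormedSpace ℝ X] [Fact (1 ≤ p)]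
    {Ψ : X → E3 → E3} (hm : ∀ w, AEStronglyMeasurable (Ψ w) μ)
    (hadd : ∀ w w', Ψ (w + w') =ᵐ[μ] fun x => Ψ w x + Ψ w' x)
    (hsmul : ∀ (c : ℝ) w, Ψ (c • w) =ᵐ[μ] fun x => c • Ψ w x) {C : ℝ} (hC0 : 0 ≤ C)
    (hC : ∀ w, eLpNorm (Ψ w) p μ ≤ ENNReal.ofReal (C * ‖w‖)) :
    ∃ L : X →L[ℝ] Lp E3 p μ, (∀ w, L w =ᵐ[μ] Ψ w) ∧ ∀ w, ‖L w‖ ≤ C * ‖w‖ := by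
  have hmem : ∀ w, MemLp (Ψ w) p μ := fun w =>
    ⟨hm w, (hC w).trans_lt ENNReal.ofReal_lt_top⟩
  let L₀ : X →ₗ[ℝ] Lp E3 p μ :=
    { toFun := fun w => (hmem w).toLp (Ψ w)
      map_add' := fun w w' => by
        rw [← MemLp.toLp_add]
        exact MemLp.toLp_congr _ _ (hadd w w')
      map_smul' := fun c w => by
        rw [RingHom.id_apply, ← MemLp.toLp_const_smul]
        exact MemLp.toLp_congr _ _ (hsmul c w) }
  have hL₀ : ∀ w, ‖L₀ w‖ ≤ C * ‖w‖ := fun w => by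
    change ‖(hmem w).toLp (Ψ w)‖ ≤ _
    rw [Lp.norm_toLp]
    exact ENNReal.toReal_le_of_le_ofReal (by positivity) (hC w)
  exact ⟨L₀.mkContinuous C hL₀, fun w => (hmem w).coeFn_toLp, hL₀⟩

lemma IsBondKernel.exists_clm {X : Type*} [NormedAddCommGroup X] [NormedSpace ℝ X]
    [Fact (1 ≤ p)] (hk : IsBondKernel k m) (hm0 : 0 ≤ m) [SFinite μ] (hp : p ≠ ∞)
    {Φ : X → E3 → E3 → E3} (hΦ : ∀ w, Measurable (Function.uncurry (Φ w)))
    (hadd : ∀ w w', ∀ᵐ x ∂μ, ∀ᵐ z, Φ (w + w') x z = Φ w x z + Φ w' x z)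
    (hsmul : ∀ (c : ℝ) w, ∀ᵐ x ∂μ, ∀ᵐ z, Φ (c • w) x z = c • Φ w x z) {C : ℝ} (hC0 : 0 ≤ C)
    (hC : ∀ w z, eLpNorm (fun x => Φ w x z) p μ ≤ ENNReal.ofReal (C * ‖w‖)) :
    ∃ L : X →L[ℝ] Lp E3 p μ, (∀ w, L w =ᵐ[μ] bondInt k (Φ w)) ∧ ∀ w, ‖L w‖ ≤ m * C * ‖w‖ := by
  have hb := fun w => hk.bondInt_Lp (Fact.out : 1 ≤ p) hp (hΦ w) (hC w)
  refine exists_clm_of_ae (fun w => (hk.measurable_bondInt (hΦ w)).aestronglyMeasurable)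
    (fun w w' => ?_) (fun c w => ?_) (by positivity) (fun w => ?_)
  · filter_upwards [hadd w w', (hb w).2, (hb w').2] with x hx h1 h2
    unfold bondInt
    rw [← integral_add h1 h2]
    refine integral_congr_ae ?_
    filter_upwards [hx] with z hz
    rw [hz, bond_add, smul_add]
  · filter_upwards [hsmul c w] with x hx
    unfold bondInt
    rw [← integral_smul]
    refine integral_congr_ae ?_
    filter_upwards [hx] with z hz
    rw [hz, bond_smul, smul_comm]
  · rw [mul_assoc]; exact (hb w).1

/-- The weight `1/|z|`, cut off at distance `r`. -/
noncomputable def cutoffWeight (r : ℝ) (z : E3) : ℝ := if ‖z‖ ≤ r then ‖z‖⁻¹ else 0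

lemma measurable_cutoffWeight (r : ℝ) : Measurable (cutoffWeight r) :=
  Measurable.ite (measurableSet_le measurable_norm measurable_const) measurable_norm.inv
    measurable_const

/-- In polar coordinates the density s² of three-dimensional space beats the singularity 1/s. -/
lemma integrable_cutoffWeight (r : ℝ) : Integrable (cutoffWeight r) := by
  have h := (integrable_fun_norm_addHaar (E := E3) volume
    (f := fun s : ℝ => if s ≤ r then s⁻¹ else 0)).2 ?_
  · exact h
  have hf : Module.finrank ℝ E3 = 3 := by simp
  rw [hf]
  have : IntegrableOn (fun s : ℝ => s) (Ioc 0 r) :=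
    (continuous_id.integrableOn_Icc).mono_set Ioc_subset_Icc_self
  have h2 := (integrable_indicator_iff measurableSet_Ioc).2 this
  refine h2.integrableOn.congr_fun (fun s hs => ?_) measurableSet_Ioi
  rw [mem_Ioi] at hs
  by_cases hsr : s ≤ r
  · have : s ∈ Ioc 0 r := ⟨hs, hsr⟩
    simp only [indicator_of_mem this, hsr, if_true, smul_eq_mul]
    field_simp
  · have : s ∉ Ioc 0 r := fun h => hsr h.2
    simp [hsr]

lemma cutoffWeight_mul {ε : ℝ} (hε : 0 < ε) (r : ℝ) (z : E3) :
    cutoffWeight (ε * r) z = ε⁻¹ * cutoffWeight r (ε⁻¹ • z) := by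
  unfold cutoffWeight
  have : ‖ε⁻¹ • z‖ = ε⁻¹ * ‖z‖ := by
    rw [norm_smul, Real.norm_of_nonneg (inv_nonneg.2 hε.le)]
  simp only [this, inv_mul_le_iff₀ hε]
  split_ifs
  · rw [mul_inv, inv_inv, inv_mul_cancel_left₀ hε.ne']
  · simp

/-- The Jacobian ε³ meets the factor 1/ε of the weight. The resulting ε² cancels the prefactor of
the short-range force. -/
lemma integral_cutoffWeight_mul {ε : ℝ} (hε : 0 < ε) (r : ℝ) :
    ∫ z, cutoffWeight (ε * r) z = ε ^ 2 * ∫ z, cutoffWeight r z := by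
  simp_rw [cutoffWeight_mul hε]
  rw [integral_const_mul, Measure.integral_comp_inv_smul]
  have hf : Module.finrank ℝ E3 = 3 := by simp
  rw [hf, abs_of_pos (by positivity), smul_eq_mul]
  field_simp

/-- A bounded measurable kernel of finite range is a bond kernel. -/
lemma isBondKernel_of_range (hm : Measurable (Function.uncurry k)) {c r : ℝ} (hc : 0 ≤ c)
    (hk : ∀ x z, |k x z| ≤ c) (hr : ∀ x z, k x z ≠ 0 → ‖z‖ ≤ r) :
    IsBondKernel k (c * ∫ z, cutoffWeight r z) := by
  refine ⟨hm, fun z => c * cutoffWeight r z, (measurable_cutoffWeight r).const_mul c,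
    (integrable_cutoffWeight r).const_mul c, (integral_const_mul _ _).le, fun x z => ?_⟩
  simp only [cutoffWeight]
  by_cases h : k x z = 0
  · rw [h, abs_zero, zero_mul]
    split_ifs <;> positivity
  · rw [if_pos (hr x z h)]
    exact mul_le_mul_of_nonneg_right (hk x z) (by positivity)

lemma integral_cutoffWeight_nonneg (r : ℝ) : 0 ≤ ∫ z, cutoffWeight r z :=
  integral_nonneg fun z => by
    simp only [cutoffWeight, Pi.zero_apply]
    split_ifs <;> positivity

end BondOperator

end Peridynamics

namespace Peridynamics

/-! ### Coefficients of the medium and uniform kernel bounds -/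

section Medium

variable (M : Medium)

lemma Medium.χf_eq_zero_or_one (y : E3) : M.χf y = 0 ∨ M.χf y = 1 := by
  by_cases h : cellRep y ∈ M.inclusion
  · exact Or.inr (indicator_of_mem h _)
  · exact Or.inl (indicator_of_notMem h _)

@[fun_prop]
lemma Medium.measurable_χf : Measurable M.χf :=
  (measurable_const.indicator M.inclusion_measurable).comp measurable_cellRep

@[fun_prop]
lemma Medium.measurable_χm : Measurable M.χm := by
  unfold Medium.χm; fun_prop

@[fun_prop]
lemma Medium.measurable_ρ : Measurable M.ρ := by
  unfold Medium.ρ; fun_prop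

@[fun_prop]
lemma Medium.measurable_α {β : Type*} [MeasurableSpace β] {f g : β → E3} (hf : Measurable f)
    (hg : Measurable g) : Measurable fun a => M.α (f a) (g a) := by
  unfold Medium.α; fun_prop

lemma Medium.ρ_eq (y : E3) : M.ρ y = M.ρm ∨ M.ρ y = M.ρf := by
  rcases M.χf_eq_zero_or_one y with h | h <;> simp [Medium.ρ, Medium.χm, h]

lemma Medium.ρ_pos (y : E3) : 0 < M.ρ y := by
  rcases M.ρ_eq y with h | h <;> rw [h]
  exacts [M.ρm_pos, M.ρf_pos]

lemma Medium.ρ_inv_le (y : E3) : (M.ρ y)⁻¹ ≤ M.ρf⁻¹ + M.ρm⁻¹ := by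
  have h1 := inv_pos.2 M.ρf_pos
  have h2 := inv_pos.2 M.ρm_pos
  rcases M.ρ_eq y with h | h <;> rw [h] <;> linarith

lemma Medium.abs_α_le (y y' : E3) : |M.α y y'| ≤ M.Cf + M.Cm + M.Ci := by
  have h1 := M.Cf_pos
  have h2 := M.Cm_pos
  have h3 := M.Ci_pos
  rcases M.χf_eq_zero_or_one y with h | h <;> rcases M.χf_eq_zero_or_one y' with h' | h' <;>
    simp only [Medium.α, Medium.χm, h, h'] <;> norm_num <;> rw [abs_of_pos (by assumption)] <;>
    linarith

lemma Medium.χf_cellRep_add (y z : E3) : M.χf (cellRep y + z) = M.χf (y + z) := by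
  unfold Medium.χf; rw [cellRep_cellRep_add]

lemma Medium.χf_cellRep (y : E3) : M.χf (cellRep y) = M.χf y := by
  simpa using M.χf_cellRep_add y 0

lemma Medium.ρ_cellRep (y : E3) : M.ρ (cellRep y) = M.ρ y := by
  simp only [Medium.ρ, Medium.χm, M.χf_cellRep]

lemma Medium.α_cellRep (y z : E3) : M.α (cellRep y) (cellRep y + z) = M.α y (y + z) := by
  simp only [Medium.α, Medium.χm, M.χf_cellRep, M.χf_cellRep_add]

/-- The kernel of the long-range bonds, divided by the density. -/
noncomputable def longKernel (ε : ℝ) (x z : E3) : ℝ :=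
  if ‖z‖ ≤ M.γ then (M.ρ (ε⁻¹ • x))⁻¹ * M.lam else 0

/-- The kernel of the short-range bonds, divided by the density. -/
noncomputable def shortKernel (ε : ℝ) (x z : E3) : ℝ :=
  if ‖z‖ < ε * M.δ then
    (M.ρ (ε⁻¹ • x))⁻¹ * ((1 / ε ^ 2) * M.α (ε⁻¹ • x) (ε⁻¹ • (x + z))) else 0

lemma IsBondKernel.mono {k : E3 → E3 → ℝ} {m m' : ℝ} (h : IsBondKernel k m) (hm : m ≤ m') :
    IsBondKernel k m' :=
  ⟨h.1, let ⟨κ, a, b, c, d⟩ := h.2; ⟨κ, a, b, c.trans hm, d⟩⟩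

lemma measurable_longKernel (ε : ℝ) : Measurable (Function.uncurry (longKernel M ε)) :=
  Measurable.ite (measurableSet_le (by fun_prop) measurable_const) (by fun_prop) measurable_const

lemma measurable_shortKernel (ε : ℝ) : Measurable (Function.uncurry (shortKernel M ε)) :=
  Measurable.ite (measurableSet_lt (by fun_prop) measurable_const) (by fun_prop) measurable_const

lemma abs_longKernel_le (ε : ℝ) (x z : E3) :
    |longKernel M ε x z| ≤ (M.ρf⁻¹ + M.ρm⁻¹) * M.lam := by
  have hρ : 0 < M.ρf⁻¹ + M.ρm⁻¹ := add_pos (inv_pos.2 M.ρf_pos) (inv_pos.2 M.ρm_pos)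
  have hlam := M.lam_pos
  unfold longKernel
  split_ifs
  · rw [abs_of_nonneg (mul_nonneg (inv_nonneg.2 (M.ρ_pos _).le) hlam.le)]
    exact mul_le_mul_of_nonneg_right (M.ρ_inv_le _) hlam.le
  · rw [abs_zero]; positivity

lemma abs_shortKernel_le {ε : ℝ} (hε : 0 < ε) (x z : E3) :
    |shortKernel M ε x z| ≤ (M.ρf⁻¹ + M.ρm⁻¹) * (M.Cf + M.Cm + M.Ci) * (1 / ε ^ 2) := by
  have hρ : 0 < M.ρf⁻¹ + M.ρm⁻¹ := add_pos (inv_pos.2 M.ρf_pos) (inv_pos.2 M.ρm_pos)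
  have hC : 0 < M.Cf + M.Cm + M.Ci := by linarith [M.Cf_pos, M.Cm_pos, M.Ci_pos]
  unfold shortKernel
  split_ifs
  · rw [abs_mul, abs_mul, abs_of_pos (inv_pos.2 (M.ρ_pos _)),
      abs_of_pos (by positivity : 0 < 1 / ε ^ 2)]
    calc (M.ρ (ε⁻¹ • x))⁻¹ * (1 / ε ^ 2 * |M.α (ε⁻¹ • x) (ε⁻¹ • (x + z))|)
        ≤ (M.ρf⁻¹ + M.ρm⁻¹) * (1 / ε ^ 2 * (M.Cf + M.Cm + M.Ci)) :=
          mul_le_mul (M.ρ_inv_le _)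
            (mul_le_mul_of_nonneg_left (M.abs_α_le _ _) (by positivity)) (by positivity) hρ.le
      _ = _ := by ring
  · rw [abs_zero]; positivity

lemma norm_le_of_longKernel_ne_zero {ε : ℝ} {x z : E3} (h : longKernel M ε x z ≠ 0) :
    ‖z‖ ≤ M.γ := by
  by_contra h'
  exact h (if_neg h')

lemma norm_lt_of_shortKernel_ne_zero {ε : ℝ} {x z : E3} (h : shortKernel M ε x z ≠ 0) :
    ‖z‖ < ε * M.δ := by
  by_contra h'
  exact h (if_neg h')

/-- Both kernels have masses that are bounded uniformly in the scale. -/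
lemma exists_isBondKernel : ∃ m : ℝ, 0 ≤ m ∧ ∀ ε : ℝ, 0 < ε →
    IsBondKernel (longKernel M ε) m ∧ IsBondKernel (shortKernel M ε) m := by
  have hρ : 0 < M.ρf⁻¹ + M.ρm⁻¹ := add_pos (inv_pos.2 M.ρf_pos) (inv_pos.2 M.ρm_pos)
  have hC : 0 < M.Cf + M.Cm + M.Ci := by linarith [M.Cf_pos, M.Cm_pos, M.Ci_pos]
  have hcL0 : 0 ≤ (M.ρf⁻¹ + M.ρm⁻¹) * M.lam := mul_nonneg hρ.le M.lam_pos.le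
  have hcS0 : 0 ≤ (M.ρf⁻¹ + M.ρm⁻¹) * (M.Cf + M.Cm + M.Ci) := mul_nonneg hρ.le hC.le
  have hL0 := mul_nonneg hcL0 (integral_cutoffWeight_nonneg M.γ)
  have hS0 := mul_nonneg hcS0 (integral_cutoffWeight_nonneg M.δ)
  refine ⟨_, add_nonneg hL0 hS0, fun ε hε => ⟨?_, ?_⟩⟩
  · exact (isBondKernel_of_range (measurable_longKernel M ε) hcL0 (abs_longKernel_le M ε)
      fun x z => norm_le_of_longKernel_ne_zero M).mono (le_add_of_nonneg_right hS0)
  · have h := isBondKernel_of_range (measurable_shortKernel M ε) (mul_nonneg hcS0 (by positivity))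
      (abs_shortKernel_le M hε) fun x z h => (norm_lt_of_shortKernel_ne_zero M h).le
    rw [integral_cutoffWeight_mul hε] at h
    have he : (M.ρf⁻¹ + M.ρm⁻¹) * (M.Cf + M.Cm + M.Ci) * (1 / ε ^ 2) *
        (ε ^ 2 * ∫ z, cutoffWeight M.δ z) =
        (M.ρf⁻¹ + M.ρm⁻¹) * (M.Cf + M.Cm + M.Ci) * ∫ z, cutoffWeight M.δ z := by
      field_simp
    exact h.mono (he.le.trans (le_add_of_nonneg_left hL0))

end Medium

/-! ### Displacement fields and the operators they generate -/

section Displacements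

variable (Ω : Set E3) {p : ℝ≥0∞}

/-- Relative displacements of a field on `Ω`. -/
noncomputable def dispField (v : E3 → E3) (x z : E3) : E3 :=
  Ω.indicator (fun x' => v x' - v x) (x + z)

variable {Ω}

/-- The cell average of a two-scale field. -/
noncomputable def cellAverage (w : TwoScale Ω p) (x : E3) : E3 :=
  ∫ y in unitCell, perVal w x y

/-- Displacements relative to the cell average, along `y = x / ε`. -/
noncomputable def dispAverage (ε : ℝ) (w : TwoScale Ω p) (x z : E3) : E3 :=
  Ω.indicator (fun x' => cellAverage w x' - perVal w x (ε⁻¹ • x)) (x + z)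

/-- Relative displacements in the fast variable, along `y = x / ε`. -/
noncomputable def dispFast (ε : ℝ) (w : TwoScale Ω p) (x z : E3) : E3 :=
  perVal w x (ε⁻¹ • (x + z)) - perVal w x (ε⁻¹ • x)

lemma measurable_perVal_comp (w : TwoScale Ω p) {α : Type*} [MeasurableSpace α] {f g : α → E3}
    (hf : Measurable f) (hg : Measurable g) : Measurable fun a => perVal w (f a) (g a) :=
  (measurable_perVal w).comp (hf.prodMk hg)

lemma measurable_cellAverage (w : TwoScale Ω p) : Measurable (cellAverage w) :=
  (StronglyMeasurable.integral_prod_right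
    (measurable_perVal w).stronglyMeasurable).measurable

lemma measurable_indicator_add (hΩ : MeasurableSet Ω) {f : E3 → E3 → E3}
    (hf : Measurable fun q : E3 × E3 => f q.1 q.2) :
    Measurable fun q : E3 × E3 => Ω.indicator (f q.1) (q.1 + q.2) := by
  have h1 : Measurable fun q : E3 × E3 => f q.1 (q.1 + q.2) :=
    hf.comp (by fun_prop : Measurable fun q : E3 × E3 => (q.1, q.1 + q.2))
  have h2 : MeasurableSet ((fun q : E3 × E3 => q.1 + q.2) ⁻¹' Ω) := hΩ.preimage (by fun_prop)
  exact h1.indicator h2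

lemma measurable_dispField (hΩ : MeasurableSet Ω) {v : E3 → E3} (hv : Measurable v) :
    Measurable (Function.uncurry (dispField Ω v)) :=
  measurable_indicator_add hΩ (f := fun x x' => v x' - v x) (by fun_prop)

lemma measurable_dispAverage (hΩ : MeasurableSet Ω) (ε : ℝ) (w : TwoScale Ω p) :
    Measurable (Function.uncurry (dispAverage ε w)) :=
  measurable_indicator_add hΩ (f := fun x x' => cellAverage w x' - perVal w x (ε⁻¹ • x))
    (((measurable_cellAverage w).comp measurable_snd).sub
      (measurable_perVal_comp w (by fun_prop) (by fun_prop)))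

lemma measurable_dispFast (ε : ℝ) (w : TwoScale Ω p) :
    Measurable (Function.uncurry (dispFast ε w)) :=
  (measurable_perVal_comp w (by fun_prop) (by fun_prop)).sub
    (measurable_perVal_comp w (by fun_prop) (by fun_prop))

lemma norm_perVal_le_ae (w : TwoScale Ω p) (x : E3) :
    ∀ᵐ y ∂(volume.restrict unitCell), ‖perVal w x y‖ ≤ ‖w y‖ := by
  filter_upwards [ae_restrict_mem measurableSet_unitCell] with y hy
  simpa only [cellRep_of_mem hy] using norm_perVal_le w x y

lemma cellAverage_smul (c : ℝ) (w : TwoScale Ω p) (x : E3) :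
    cellAverage (c • w) x = c • cellAverage w x := by
  unfold cellAverage
  rw [← integral_smul]
  exact integral_congr_ae ((perVal_smul c w).mono fun y hy => hy x)

lemma eLpNorm_indicator_translate_le (hΩ : MeasurableSet Ω) {v : E3 → E3}
    (hv : Measurable v) (z : E3) :
    eLpNorm (fun x => Ω.indicator v (x + z)) p (volume.restrict Ω)
      ≤ eLpNorm v p (volume.restrict Ω) := by
  have hi : AEStronglyMeasurable (Ω.indicator v) volume := (hv.indicator hΩ).aestronglyMeasurable
  have h : eLpNorm (fun x => Ω.indicator v (x + z)) p volume = eLpNorm (Ω.indicator v) p volume := by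
    have h2 := measurePreserving_add_right (volume : Measure E3) z
    have h3 := eLpNorm_comp_measurePreserving (p := p) hi h2
    exact h3
  rw [← eLpNorm_indicator_eq_eLpNorm_restrict (f := v) hΩ, ← h]
  exact eLpNorm_mono_measure _ Measure.restrict_le_self

lemma ae_ae_add_of_restrict {P : E3 → Prop} (hΩ : MeasurableSet Ω)
    (h : ∀ᵐ y ∂(volume.restrict Ω), P y) :
    ∀ᵐ x ∂(volume.restrict Ω), ∀ᵐ z : E3, x + z ∈ Ω → P (x + z) :=
  ae_restrict_of_ae (ae_ae_add ((ae_restrict_iff' hΩ).1 h))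

variable [Fact (1 ≤ p)]

lemma norm_cell_le (w : TwoScale Ω p) : ∫ y in unitCell, ‖w y‖ ≤ ‖w‖ := by
  have h1 := eLpNorm_le_eLpNorm_of_exponent_le (μ := volume.restrict unitCell) (Fact.out : 1 ≤ p)
    (Lp.stronglyMeasurable w).aestronglyMeasurable
  rw [Lp.norm_def, integral_norm_eq_lintegral_enorm (Lp.stronglyMeasurable w).aestronglyMeasurable,
    ← eLpNorm_one_eq_lintegral_enorm]
  exact ENNReal.toReal_mono (Lp.eLpNorm_ne_top w) h1

lemma integrable_norm_cell (w : TwoScale Ω p) :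
    Integrable (fun y => ‖w y‖) (volume.restrict unitCell) :=
  ((Lp.memLp w).integrable Fact.out).norm

lemma integrable_perVal (w : TwoScale Ω p) (x : E3) :
    Integrable (fun y => perVal w x y) (volume.restrict unitCell) :=
  (integrable_norm_cell w).mono'
    (measurable_perVal_comp w measurable_const measurable_id).aestronglyMeasurable
    (norm_perVal_le_ae w x)

lemma norm_cellAverage_le (w : TwoScale Ω p) (x : E3) : ‖cellAverage w x‖ ≤ ‖w‖ :=
  (norm_integral_le_of_norm_le (integrable_norm_cell w) (norm_perVal_le_ae w x)).trans
    (norm_cell_le w)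

lemma cellAverage_add (w w' : TwoScale Ω p) (x : E3) :
    cellAverage (w + w') x = cellAverage w x + cellAverage w' x := by
  unfold cellAverage
  rw [← integral_add (integrable_perVal w x) (integrable_perVal w' x)]
  exact integral_congr_ae ((perVal_add w w').mono fun y hy => hy x)

variable {k : E3 → E3 → ℝ} {m : ℝ}

/-- The displacement is a translate of `v` cut off to Ω, minus a restriction of `v`; each costs one
norm of `v`, whence the factor 2. -/
lemma eLpNorm_dispField_le (hΩ : MeasurableSet Ω) (v : LpVec Ω p) (z : E3) :
    eLpNorm (fun x => dispField Ω v x z) p (volume.restrict Ω) ≤ ENNReal.ofReal (2 * ‖v‖) := by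
  have hv : Measurable v := (Lp.stronglyMeasurable v).measurable
  have hn : eLpNorm v p (volume.restrict Ω) = ENNReal.ofReal ‖v‖ := by
    rw [Lp.norm_def, ENNReal.ofReal_toReal (Lp.eLpNorm_ne_top v)]
  have hsub : (fun x => dispField Ω v x z) = (fun x => Ω.indicator v (x + z)) -
      ((fun x => x + z) ⁻¹' Ω).indicator v := by
    ext1 x
    simp only [dispField, Pi.sub_apply]
    by_cases h : x + z ∈ Ω
    · have h' : x ∈ (fun x => x + z) ⁻¹' Ω := h
      simp only [indicator_of_mem h, indicator_of_mem h']
    · have h' : x ∉ (fun x => x + z) ⁻¹' Ω := h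
      simp only [indicator_of_notMem h, indicator_of_notMem h', sub_zero]
  have hs : MeasurableSet ((fun x : E3 => x + z) ⁻¹' Ω) := hΩ.preimage (by fun_prop)
  rw [hsub, two_mul, ENNReal.ofReal_add (norm_nonneg _) (norm_nonneg _), ← hn]
  refine (eLpNorm_sub_le ((hv.indicator hΩ).comp (measurable_add_const z)).aestronglyMeasurable
    (hv.indicator hs).aestronglyMeasurable Fact.out).trans ?_
  exact add_le_add (eLpNorm_indicator_translate_le hΩ hv z) (eLpNorm_indicator_le _)

lemma exists_clm_dispField (hk : IsBondKernel k m) (hm0 : 0 ≤ m) (hp : p ≠ ∞)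
    (hΩ : MeasurableSet Ω) :
    ∃ L : LpVec Ω p →L[ℝ] LpVec Ω p,
      (∀ v, L v =ᵐ[volume.restrict Ω] bondInt k (dispField Ω v)) ∧ ∀ v, ‖L v‖ ≤ m * 2 * ‖v‖ := by
  refine hk.exists_clm hm0 hp (Φ := fun v : LpVec Ω p => dispField Ω v)
    (fun v => measurable_dispField hΩ (Lp.stronglyMeasurable v).measurable) (fun v v' => ?_)
    (fun c v => ?_) zero_le_two (eLpNorm_dispField_le hΩ)
  · filter_upwards [Lp.coeFn_add v v', ae_ae_add_of_restrict hΩ (Lp.coeFn_add v v')] with x hx hx'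
    filter_upwards [hx'] with z hz
    by_cases h : x + z ∈ Ω
    · simp only [dispField, indicator_of_mem h, hx, hz h, Pi.add_apply]
      abel
    · simp only [dispField, indicator_of_notMem h, add_zero]
  · filter_upwards [Lp.coeFn_smul c v, ae_ae_add_of_restrict hΩ (Lp.coeFn_smul c v)] with x hx hx'
    filter_upwards [hx'] with z hz
    by_cases h : x + z ∈ Ω
    · simp only [dispField, indicator_of_mem h, hx, hz h, Pi.smul_apply, smul_sub]
    · simp only [dispField, indicator_of_notMem h, smul_zero]

lemma exists_clm_perVal (hp : p ≠ ∞) (hb : Bornology.IsBounded Ω) :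
    ∃ C : ℝ, 0 ≤ C ∧ ∀ ε : ℝ, 0 < ε → ε ≤ 1 → ∃ S : TwoScale Ω p →L[ℝ] LpVec Ω p,
      (∀ w, S w =ᵐ[volume.restrict Ω] fun x => perVal w x (ε⁻¹ • x)) ∧ ∀ w, ‖S w‖ ≤ C * ‖w‖ := by
  obtain ⟨C, hC0, hC⟩ := exists_bound_eLpNorm_perVal (Ω := Ω) hp hb
  refine ⟨C, hC0, fun ε hε hε1 => exists_clm_of_ae (fun w =>
    (measurable_perVal_comp w (by fun_prop) (by fun_prop)).aestronglyMeasurable) (fun w w' => ?_)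
    (fun c w => ?_) hC0 (fun w => by simpa using hC w ε hε hε1 0)⟩
  · exact ae_restrict_of_ae ((perVal_add_scaled w w' hε hε1).mono fun x h => h x)
  · exact ae_restrict_of_ae ((perVal_smul_scaled c w hε hε1).mono fun x h => h x)

lemma exists_bound_disp (hp : p ≠ ∞) (hb : Bornology.IsBounded Ω) (hΩ : MeasurableSet Ω) :
    ∃ C : ℝ, 0 ≤ C ∧ ∀ ε : ℝ, 0 < ε → ε ≤ 1 → ∀ (w : TwoScale Ω p) (z : E3),
      eLpNorm (fun x => dispAverage ε w x z) p (volume.restrict Ω) ≤ ENNReal.ofReal (C * ‖w‖) ∧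
      eLpNorm (fun x => dispFast ε w x z) p (volume.restrict Ω) ≤ ENNReal.ofReal (C * ‖w‖) := by
  obtain ⟨C, hC0, hC⟩ := exists_bound_eLpNorm_perVal (Ω := Ω) hp hb
  have hfin : IsFiniteMeasure (volume.restrict Ω) :=
    ⟨by rw [Measure.restrict_apply_univ]; exact hb.measure_lt_top⟩
  -- The cell average is bounded pointwise by ‖w‖, so its L^p norm costs only this power of the
  -- volume of Ω.
  set V := ((volume.restrict Ω) univ ^ p.toReal⁻¹).toReal with hV
  have hV0 : 0 ≤ V := ENNReal.toReal_nonneg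
  refine ⟨V + C + C, by positivity, fun ε hε hε1 w z => ?_⟩
  have hm1 : ∀ z, Measurable fun x => perVal w x (ε⁻¹ • (x + z)) := fun z =>
    measurable_perVal_comp w (by fun_prop) (by fun_prop)
  have h0 : eLpNorm (fun x => perVal w x (ε⁻¹ • x)) p (volume.restrict Ω)
      ≤ ENNReal.ofReal (C * ‖w‖) := by simpa using hC w ε hε hε1 0
  have hm0 : Measurable fun x => perVal w x (ε⁻¹ • x) := by simpa using hm1 0
  have hs : MeasurableSet ((fun x : E3 => x + z) ⁻¹' Ω) := hΩ.preimage (by fun_prop)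
  constructor
  · have hsub : (fun x => dispAverage ε w x z) =
        (fun x => Ω.indicator (cellAverage w) (x + z)) -
        ((fun x => x + z) ⁻¹' Ω).indicator (fun x => perVal w x (ε⁻¹ • x)) := by
      ext1 x
      simp only [dispAverage, Pi.sub_apply]
      by_cases h : x + z ∈ Ω
      · have h' : x ∈ (fun x => x + z) ⁻¹' Ω := h
        simp only [indicator_of_mem h, indicator_of_mem h']
      · have h' : x ∉ (fun x => x + z) ⁻¹' Ω := h
        simp only [indicator_of_notMem h, indicator_of_notMem h', sub_zero]
    have hav : eLpNorm (cellAverage w) p (volume.restrict Ω) ≤ ENNReal.ofReal (V * ‖w‖) := by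
      refine (eLpNorm_le_of_ae_bound (Eventually.of_forall (norm_cellAverage_le w))).trans
        (le_of_eq ?_)
      rw [ENNReal.ofReal_mul hV0, hV, ENNReal.ofReal_toReal
        (ENNReal.rpow_ne_top_of_nonneg (by positivity) (measure_ne_top _ _))]
    rw [hsub]
    refine (eLpNorm_sub_le
      (((measurable_cellAverage w).indicator hΩ).comp (measurable_add_const z)).aestronglyMeasurable
      (hm0.indicator hs).aestronglyMeasurable Fact.out).trans ?_
    calc _ ≤ ENNReal.ofReal (V * ‖w‖) + ENNReal.ofReal (C * ‖w‖) := add_le_add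
          ((eLpNorm_indicator_translate_le hΩ (measurable_cellAverage w) z).trans hav)
          ((eLpNorm_indicator_le _).trans h0)
      _ = ENNReal.ofReal (V * ‖w‖ + C * ‖w‖) :=
          (ENNReal.ofReal_add (by positivity) (by positivity)).symm
      _ ≤ _ := ENNReal.ofReal_le_ofReal (by
          have := mul_nonneg hC0 (norm_nonneg w)
          linarith)
  · refine (eLpNorm_sub_le (hm1 z).aestronglyMeasurable hm0.aestronglyMeasurable Fact.out).trans ?_
    calc _ ≤ ENNReal.ofReal (C * ‖w‖) + ENNReal.ofReal (C * ‖w‖) :=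
          add_le_add (hC w ε hε hε1 z) h0
      _ = ENNReal.ofReal (C * ‖w‖ + C * ‖w‖) :=
          (ENNReal.ofReal_add (by positivity) (by positivity)).symm
      _ ≤ _ := ENNReal.ofReal_le_ofReal (by
          have := mul_nonneg hV0 (norm_nonneg w)
          linarith)

lemma exists_clm_dispAverage (hk : IsBondKernel k m) (hm0 : 0 ≤ m) (hp : p ≠ ∞)
    (hΩ : MeasurableSet Ω) {C : ℝ} (hC0 : 0 ≤ C) {ε : ℝ} (hε : 0 < ε) (hε1 : ε ≤ 1)
    (hC : ∀ (w : TwoScale Ω p) (z : E3),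
      eLpNorm (fun x => dispAverage ε w x z) p (volume.restrict Ω) ≤ ENNReal.ofReal (C * ‖w‖)) :
    ∃ L : TwoScale Ω p →L[ℝ] LpVec Ω p,
      (∀ w, L w =ᵐ[volume.restrict Ω] bondInt k (dispAverage ε w)) ∧
        ∀ w, ‖L w‖ ≤ m * C * ‖w‖ := by
  refine hk.exists_clm hm0 hp (fun w => measurable_dispAverage hΩ ε w) (fun w w' => ?_)
    (fun c w => ?_) hC0 hC
  · filter_upwards [ae_restrict_of_ae (perVal_add_scaled w w' hε hε1)] with x hx
    refine Eventually.of_forall fun z => ?_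
    by_cases h : x + z ∈ Ω
    · simp only [dispAverage, indicator_of_mem h, hx, cellAverage_add]
      abel
    · simp only [dispAverage, indicator_of_notMem h, add_zero]
  · filter_upwards [ae_restrict_of_ae (perVal_smul_scaled c w hε hε1)] with x hx
    refine Eventually.of_forall fun z => ?_
    by_cases h : x + z ∈ Ω
    · simp only [dispAverage, indicator_of_mem h, hx, cellAverage_smul, smul_sub]
    · simp only [dispAverage, indicator_of_notMem h, smul_zero]

lemma exists_clm_dispFast (hk : IsBondKernel k m) (hm0 : 0 ≤ m) (hp : p ≠ ∞)
    {C : ℝ} (hC0 : 0 ≤ C) {ε : ℝ} (hε : 0 < ε) (hε1 : ε ≤ 1)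
    (hC : ∀ (w : TwoScale Ω p) (z : E3),
      eLpNorm (fun x => dispFast ε w x z) p (volume.restrict Ω) ≤ ENNReal.ofReal (C * ‖w‖)) :
    ∃ L : TwoScale Ω p →L[ℝ] LpVec Ω p,
      (∀ w, L w =ᵐ[volume.restrict Ω] bondInt k (dispFast ε w)) ∧
        ∀ w, ‖L w‖ ≤ m * C * ‖w‖ := by
  refine hk.exists_clm hm0 hp (fun w => measurable_dispFast ε w) (fun w w' => ?_)
    (fun c w => ?_) hC0 hC
  · have h := perVal_add_scaled w w' hε hε1
    filter_upwards [ae_restrict_of_ae h, ae_restrict_of_ae (ae_ae_add h)] with x hx hx'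
    filter_upwards [hx'] with z hz
    simp only [dispFast, hx, hz]
    abel
  · have h := perVal_smul_scaled c w hε hε1
    filter_upwards [ae_restrict_of_ae h, ae_restrict_of_ae (ae_ae_add h)] with x hx hx'
    filter_upwards [hx'] with z hz
    simp only [dispFast, hx, hz, smul_sub]

end Displacements

end Peridynamics

namespace Peridynamics

/-! ### Consistency errors of product fields -/

section Consistency

/-- Bounded convergence in `L^p` over a finite measure space. -/
lemma tendsto_eLpNorm_of_bounded {μ : Measure E3} [IsFiniteMeasure μ] {p : ℝ≥0∞} (hp0 : p ≠ 0)
    (hp : p ≠ ∞) {l : Filter ℝ} [l.IsCountablyGenerated] {f : ℝ → E3 → E3} {C : ℝ}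
    (hf : ∀ᶠ ε in l, Measurable (f ε)) (hC : ∀ᶠ ε in l, ∀ x, ‖f ε x‖ ≤ C)
    (hlim : ∀ᵐ x ∂μ, Tendsto (fun ε => f ε x) l (𝓝 0)) :
    Tendsto (fun ε => eLpNorm (f ε) p μ) l (𝓝 0) := by
  have hpr : 0 < p.toReal := ENNReal.toReal_pos hp0 hp
  have h : Tendsto (fun ε => ∫⁻ x, ‖f ε x‖ₑ ^ p.toReal ∂μ) l (𝓝 (∫⁻ _, 0 ∂μ)) := by
    refine tendsto_lintegral_filter_of_dominated_convergence
      (fun _ => ENNReal.ofReal C ^ p.toReal) (hf.mono fun ε h => h.enorm.pow_const _) ?_ ?_ ?_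
    · filter_upwards [hC] with ε hε
      refine Eventually.of_forall fun x => ENNReal.rpow_le_rpow ?_ hpr.le
      rw [← ofReal_norm]
      exact ENNReal.ofReal_le_ofReal (hε x)
    · rw [lintegral_const]
      exact ENNReal.mul_ne_top (ENNReal.rpow_ne_top_of_nonneg hpr.le ENNReal.ofReal_ne_top)
        (measure_ne_top _ _)
    · filter_upwards [hlim] with x hx
      have h1 := hx.enorm
      rw [enorm_zero] at h1
      have h2 := h1.ennrpow_const p.toReal
      rwa [ENNReal.zero_rpow_of_pos hpr] at h2
  rw [lintegral_zero] at h
  have h2 := h.ennrpow_const (1 / p.toReal)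
  rw [ENNReal.zero_rpow_of_pos (by positivity)] at h2
  refine h2.congr fun ε => ?_
  rw [eLpNorm_eq_lintegral_rpow_enorm_toReal hp0 hp]

lemma bondInt_sub_ae {k : E3 → E3 → ℝ} {μ : Measure E3} {Φ₁ Φ₂ Ψ : E3 → E3 → E3}
    (h₁ : ∀ᵐ x ∂μ, Integrable fun z => k x z • bond z (Φ₁ x z))
    (h₂ : ∀ᵐ x ∂μ, Integrable fun z => k x z • bond z (Φ₂ x z))
    (h : ∀ᵐ x ∂μ, ∀ᵐ z, Φ₁ x z - Φ₂ x z = Ψ x z) :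
    ∀ᵐ x ∂μ, bondInt k Φ₁ x - bondInt k Φ₂ x = bondInt k Ψ x := by
  filter_upwards [h₁, h₂, h] with x h₁ h₂ h
  unfold bondInt
  rw [← integral_sub h₁ h₂]
  refine integral_congr_ae ?_
  filter_upwards [h] with z hz
  rw [← hz, bond_sub, smul_sub]

variable {Ω : Set E3} {p : ℝ≥0∞}

open Classical in
/-- Extension by zero of a field on the closure of `Ω`. -/
noncomputable def zeroExt (c : closure Ω →ᵇ E3) (x : E3) : E3 :=
  if h : x ∈ closure Ω then c ⟨x, h⟩ else 0

lemma norm_zeroExt_le (c : closure Ω →ᵇ E3) (x : E3) : ‖zeroExt c x‖ ≤ ‖c‖ := by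
  unfold zeroExt
  split_ifs with h
  · exact c.norm_coe_le_norm _
  · simp

lemma measurable_zeroExt (c : closure Ω →ᵇ E3) : Measurable (zeroExt c) := by
  classical
  exact Measurable.dite (s := closure Ω) (f := fun x => c x) (g := fun _ => (0 : E3))
    c.continuous.measurable measurable_const isClosed_closure.measurableSet

lemma continuousOn_zeroExt (c : closure Ω →ᵇ E3) : ContinuousOn (zeroExt c) (closure Ω) := by
  rw [continuousOn_iff_continuous_domRestrict]
  refine c.continuous.congr fun x => ?_
  simp [zeroExt]

/-- Real-valued indicator function. -/
noncomputable def ind (s : Set E3) (y : E3) : ℝ := s.indicator (fun _ => (1 : ℝ)) y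

lemma measurable_ind {s : Set E3} (hs : MeasurableSet s) : Measurable (ind s) :=
  measurable_const.indicator hs

lemma ind_nonneg (s : Set E3) (y : E3) : 0 ≤ ind s y := indicator_nonneg (fun _ _ => zero_le_one) y

lemma ind_le_one (s : Set E3) (y : E3) : ind s y ≤ 1 :=
  indicator_le_self' (fun _ _ => zero_le_one) y

/-- The mean of the indicator function over the cell. -/
noncomputable def indMean (s : Set E3) : ℝ := ∫ y in unitCell, ind s y

lemma integrable_ind {s : Set E3} (hs : MeasurableSet s) :
    Integrable (ind s) (volume.restrict unitCell) :=
  (integrable_const (1 : ℝ)).mono' (measurable_ind hs).aestronglyMeasurable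
    (Eventually.of_forall fun y => by
      rw [Real.norm_of_nonneg (ind_nonneg s y)]; exact ind_le_one s y)

lemma abs_ind_sub_indMean_le {s : Set E3} (hs : MeasurableSet s) (y : E3) :
    |ind s y - indMean s| ≤ 1 := by
  have h0 : 0 ≤ indMean s := integral_nonneg (ind_nonneg s)
  have h1 : indMean s ≤ 1 := by
    calc indMean s ≤ ∫ _ in unitCell, (1 : ℝ) :=
          integral_mono (integrable_ind hs) (integrable_const _) (ind_le_one s)
      _ = 1 := by simp
  rw [abs_le]
  constructor <;> linarith [ind_nonneg s y, ind_le_one s y]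

/-- The two-scale field with values `c` for `y ∈ s` and zero elsewhere. -/
def IsProductField (w : TwoScale Ω p) (s : Set E3) (c : closure Ω →ᵇ E3) : Prop :=
  ∀ᵐ y ∂(volume.restrict unitCell), ∀ x, perVal w x y = ind s (cellRep y) • zeroExt c x

lemma isProductField_indicatorConst {s : Set E3} (hs : MeasurableSet s)
    (hμs : (volume.restrict unitCell) s ≠ ∞) (c : closure Ω →ᵇ E3) :
    IsProductField (Lp.simpleFunc.indicatorConst p hs hμs c : TwoScale Ω p) s c := by
  rw [IsProductField, Lp.simpleFunc.coe_indicatorConst]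
  filter_upwards [indicatorConstLp_coeFn (p := p) (hs := hs) (hμs := hμs) (c := c),
    ae_restrict_mem measurableSet_unitCell] with y hy hy' x
  unfold perVal zeroExt
  rw [cellRep_of_mem hy', hy]
  by_cases h : y ∈ s
  · simp [ind, indicator_of_mem h]
  · simp [ind, indicator_of_notMem h]

variable {w : TwoScale Ω p} {s : Set E3} {c : closure Ω →ᵇ E3}

lemma IsProductField.scaled (hw : IsProductField w s c) {ε : ℝ} (hε : 0 < ε) (hε1 : ε ≤ 1) :
    ∀ᵐ x' : E3, ∀ x, perVal w x (ε⁻¹ • x') = ind s (cellRep (ε⁻¹ • x')) • zeroExt c x :=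
  ae_scaled (P := fun y => ∀ x, perVal w x y = ind s (cellRep y) • zeroExt c x) hw
    (fun y h x => by simpa only [perVal_cellRep, cellRep_cellRep] using h x) hε hε1

lemma IsProductField.cellAverage_eq (hw : IsProductField w s c) (x : E3) :
    cellAverage w x = indMean s • zeroExt c x := by
  unfold cellAverage indMean
  rw [← integral_smul_const]
  refine integral_congr_ae ?_
  filter_upwards [hw, ae_restrict_mem measurableSet_unitCell] with y hy hy'
  rw [hy, cellRep_of_mem hy']

variable (Ω) in
/-- Long-range consistency error for a product field. -/
noncomputable def longDefect (s : Set E3) (φ : E3 → E3) (ε : ℝ) (x z : E3) : E3 :=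
  Ω.indicator (fun x' => (ind s (cellRep (ε⁻¹ • x')) - indMean s) • φ x') (x + z)

variable (Ω) in
/-- Short-range consistency error for a product field. -/
noncomputable def shortDefect (s : Set E3) (φ : E3 → E3) (ε : ℝ) (x z : E3) : E3 :=
  Ω.indicator (fun x' => ind s (cellRep (ε⁻¹ • x')) • φ x' - ind s (cellRep (ε⁻¹ • x)) • φ x)
    (x + z) -
  (ind s (cellRep (ε⁻¹ • (x + z))) • φ x - ind s (cellRep (ε⁻¹ • x)) • φ x)

lemma measurable_longDefect (hΩ : MeasurableSet Ω) (hs : MeasurableSet s) {φ : E3 → E3}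
    (hφ : Measurable φ) (ε : ℝ) : Measurable (Function.uncurry (longDefect Ω s φ ε)) := by
  have h := measurable_ind hs
  exact measurable_indicator_add hΩ
    (f := fun _ x' => (ind s (cellRep (ε⁻¹ • x')) - indMean s) • φ x') (by fun_prop)

lemma measurable_shortDefect (hΩ : MeasurableSet Ω) (hs : MeasurableSet s) {φ : E3 → E3}
    (hφ : Measurable φ) (ε : ℝ) : Measurable (Function.uncurry (shortDefect Ω s φ ε)) := by
  have h := measurable_ind hs
  have h1 := measurable_indicator_add hΩ
    (f := fun x x' => ind s (cellRep (ε⁻¹ • x')) • φ x' - ind s (cellRep (ε⁻¹ • x)) • φ x)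
    (by fun_prop)
  have h2 : Measurable fun q : E3 × E3 =>
    ind s (cellRep (ε⁻¹ • (q.1 + q.2))) • φ q.1 - ind s (cellRep (ε⁻¹ • q.1)) • φ q.1 := by fun_prop
  exact h1.sub h2

lemma norm_longDefect_le (hs : MeasurableSet s) {φ : E3 → E3} {B : ℝ} (hB : ∀ x, ‖φ x‖ ≤ B)
    (ε : ℝ) (x z : E3) : ‖longDefect Ω s φ ε x z‖ ≤ B := by
  have hB0 : 0 ≤ B := (norm_nonneg _).trans (hB 0)
  refine (norm_indicator_le_norm_self _ _).trans ?_
  rw [norm_smul, Real.norm_eq_abs]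
  calc _ ≤ 1 * B := mul_le_mul (abs_ind_sub_indMean_le hs _) (hB _) (norm_nonneg _) zero_le_one
    _ = B := one_mul B

lemma norm_ind_smul_le (s : Set E3) (y η : E3) : ‖ind s y • η‖ ≤ ‖η‖ := by
  rw [norm_smul, Real.norm_of_nonneg (ind_nonneg s y)]
  exact mul_le_of_le_one_left (norm_nonneg _) (ind_le_one s y)

lemma norm_shortDefect_le {φ : E3 → E3} {B : ℝ} (hB : ∀ x, ‖φ x‖ ≤ B)
    (ε : ℝ) (x z : E3) : ‖shortDefect Ω s φ ε x z‖ ≤ 4 * B := by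
  have h2 : ∀ a b η η', ‖η‖ ≤ B → ‖η'‖ ≤ B → ‖ind s a • η - ind s b • η'‖ ≤ 2 * B :=
    fun a b η η' h h' => (norm_sub_le _ _).trans (by
      linarith [norm_ind_smul_le s a η, norm_ind_smul_le s b η'])
  calc ‖shortDefect Ω s φ ε x z‖ ≤ 2 * B + 2 * B :=
        (norm_sub_le _ _).trans (add_le_add ((norm_indicator_le_norm_self _ _).trans
          (h2 _ _ _ _ (hB _) (hB _))) (h2 _ _ _ _ (hB _) (hB _)))
    _ = 4 * B := by ring

/-- The terms at x cancel, leaving the oscillation only as a bounded factor in front of an increment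
of `φ`. -/
lemma shortDefect_of_mem {φ : E3 → E3} {ε : ℝ} {x z : E3} (h : x + z ∈ Ω) :
    shortDefect Ω s φ ε x z = ind s (cellRep (ε⁻¹ • (x + z))) • (φ (x + z) - φ x) := by
  simp only [shortDefect, indicator_of_mem h, smul_sub]
  abel

variable (M : Medium)

/-- Once εδ is below a radius on which the ball about x lies in Ω and `φ` varies little, every
active bond has small defect, while the kernel mass stays bounded. -/
lemma tendsto_bondInt_shortDefect {φ : E3 → E3} (hΩ : IsOpen Ω) (hs : MeasurableSet s)
    (hφm : Measurable φ) (hφ : ContinuousOn φ Ω) {x : E3} (hx : x ∈ Ω) :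
    Tendsto (fun ε => bondInt (shortKernel M ε) (shortDefect Ω s φ ε) x) (𝓝[>] 0) (𝓝 0) := by
  obtain ⟨m, hm0, hm⟩ := exists_isBondKernel M
  rw [Metric.tendsto_nhds]
  intro η hη
  have hη' : 0 < η / (m + 1) := by positivity
  have hc : ∀ᶠ x' in 𝓝 x, x' ∈ Ω ∧ ‖φ x' - φ x‖ ≤ η / (m + 1) := by
    refine (hΩ.eventually_mem hx).and ?_
    have := Metric.tendsto_nhds.1 (hφ.continuousAt (hΩ.mem_nhds hx)) _ hη'
    exact this.mono fun x' h => by rw [← dist_eq_norm]; exact h.le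
  obtain ⟨r, hr, hr'⟩ := Metric.eventually_nhds_iff.1 hc
  have hδ := M.δ_pos
  filter_upwards [self_mem_nhdsWithin,
    mem_nhdsWithin_of_mem_nhds (Iio_mem_nhds (div_pos hr hδ))] with ε hε hεr
  rw [mem_Ioi] at hε
  rw [mem_Iio, lt_div_iff₀ hδ] at hεr
  rw [dist_zero_right]
  have h := ((hm ε hε).2.bondInt_bounded
    (measurable_shortDefect hΩ.measurableSet hs hφm ε) hη'.le (x := x) (fun z hz => ?_)).1
  · refine h.trans_lt ?_
    rw [mul_div_assoc', div_lt_iff₀ (by positivity)]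
    nlinarith
  · have hz' := norm_lt_of_shortKernel_ne_zero M hz
    have hmem := hr' (y := x + z) (by
      rw [dist_eq_norm, add_sub_cancel_left]; exact hz'.trans hεr)
    rw [shortDefect_of_mem hmem.1]
    exact (norm_ind_smul_le _ _ _).trans hmem.2

lemma tendsto_bondInt_longDefect {φ : E3 → E3} (hΩ : MeasurableSet Ω) (hs : MeasurableSet s)
    (hφm : Measurable φ) {B : ℝ} (hB : ∀ x, ‖φ x‖ ≤ B) (x : E3) :
    Tendsto (fun ε => bondInt (longKernel M ε) (longDefect Ω s φ ε) x) (𝓝[>] 0) (𝓝 0) := by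
  have hB0 : 0 ≤ B := (norm_nonneg _).trans (hB 0)
  -- The density at x/ε does not involve the integration variable and is factored out. What remains
  -- is a kernel independent of ε, so the oscillation is tested against one fixed integrable field
  -- `g`.
  set k₀ : E3 → E3 → ℝ := fun _ z => if ‖z‖ ≤ M.γ then M.lam else 0 with hk₀
  have hk : IsBondKernel k₀ (M.lam * ∫ z, cutoffWeight M.γ z) := by
    refine isBondKernel_of_range ?_ M.lam_pos.le (fun x z => ?_) fun x z h => ?_
    · exact Measurable.ite (measurableSet_le (by fun_prop) measurable_const) measurable_const
        measurable_const
    · simp only [hk₀]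
      split_ifs
      · exact (abs_of_pos M.lam_pos).le
      · rw [abs_zero]; exact M.lam_pos.le
    · by_contra h'
      exact h (if_neg h')
  set Φ₀ : E3 → E3 → E3 := fun x z => Ω.indicator φ (x + z) with hΦ₀
  have hΦ₀m : Measurable (Function.uncurry Φ₀) :=
    measurable_indicator_add hΩ (f := fun _ x' => φ x') (by fun_prop)
  set g : E3 → E3 := fun z => k₀ x z • bond z (Φ₀ x z) with hg
  have hgi : Integrable g := (hk.bondInt_bounded hΦ₀m hB0 (x := x) fun z _ =>
    (norm_indicator_le_norm_self _ _).trans (hB _)).2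
  have hG : Integrable fun x' => g (x' - x) := hgi.comp_sub_right x
  have hmi := measurable_ind hs
  have hlim := tendsto_integral_periodic_smul (h := fun y => ind s y - indMean s)
    (by fun_prop) (abs_ind_sub_indMean_le hs) (by
      rw [integral_sub (integrable_ind hs) (integrable_const _), integral_const]
      simp [indMean]) hG
  have hkey : ∀ ε, bondInt (longKernel M ε) (longDefect Ω s φ ε) x =
      (M.ρ (ε⁻¹ • x))⁻¹ • ∫ x', (ind s (cellRep (ε⁻¹ • x')) - indMean s) • g (x' - x) := by
    intro ε
    rw [← integral_add_left_eq_self _ x, ← integral_smul]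
    unfold bondInt
    refine integral_congr_ae (Eventually.of_forall fun z => ?_)
    simp only [hg, hk₀, hΦ₀, add_sub_cancel_left, longKernel, longDefect]
    by_cases hz : ‖z‖ ≤ M.γ
    · by_cases hxz : x + z ∈ Ω
      · simp only [if_pos hz, indicator_of_mem hxz, bond_smul, smul_smul]
        congr 1; ring
      · simp only [indicator_of_notMem hxz, bond_zero, smul_zero]
    · simp only [if_neg hz, zero_smul, smul_zero]
  have h0 : Tendsto (fun ε : ℝ => (M.ρf⁻¹ + M.ρm⁻¹) *
      ‖∫ x', (ind s (cellRep (ε⁻¹ • x')) - indMean s) • g (x' - x)‖) (𝓝[>] 0) (𝓝 0) := by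
    have := (hlim.norm).const_mul (M.ρf⁻¹ + M.ρm⁻¹)
    rwa [norm_zero, mul_zero] at this
  refine squeeze_zero_norm (fun ε => ?_) h0
  rw [hkey, norm_smul, Real.norm_of_nonneg (inv_nonneg.2 (M.ρ_pos _).le)]
  exact mul_le_mul_of_nonneg_right (M.ρ_inv_le _) (norm_nonneg _)

variable [Fact (1 ≤ p)]

/-- Both consistency errors of a product field vanish in the limit. -/
lemma tendsto_eLpNorm_defect (hp : p ≠ ∞) (hΩ : IsOpen Ω) (hb : Bornology.IsBounded Ω)
    (hs : MeasurableSet s) (c : closure Ω →ᵇ E3) :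
    Tendsto (fun ε => eLpNorm (bondInt (longKernel M ε) (longDefect Ω s (zeroExt c) ε)) p
      (volume.restrict Ω)) (𝓝[>] 0) (𝓝 0) ∧
    Tendsto (fun ε => eLpNorm (bondInt (shortKernel M ε) (shortDefect Ω s (zeroExt c) ε)) p
      (volume.restrict Ω)) (𝓝[>] 0) (𝓝 0) := by
  obtain ⟨m, hm0, hm⟩ := exists_isBondKernel M
  have hfin : IsFiniteMeasure (volume.restrict Ω) :=
    ⟨by rw [Measure.restrict_apply_univ]; exact hb.measure_lt_top⟩
  have hp0 : p ≠ 0 := (zero_lt_one.trans_le (Fact.out : 1 ≤ p)).ne'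
  have hΩm := hΩ.measurableSet
  have hφm := measurable_zeroExt c
  constructor
  · refine tendsto_eLpNorm_of_bounded (C := m * ‖c‖) hp0 hp ?_ ?_ (Eventually.of_forall fun x =>
      tendsto_bondInt_longDefect M hΩm hs hφm (norm_zeroExt_le c) x)
    · filter_upwards [self_mem_nhdsWithin] with ε hε
      exact (hm ε hε).1.measurable_bondInt (measurable_longDefect hΩm hs hφm ε)
    · filter_upwards [self_mem_nhdsWithin] with ε hε x
      exact ((hm ε hε).1.bondInt_bounded (measurable_longDefect hΩm hs hφm ε) (norm_nonneg c)
        fun z _ => norm_longDefect_le hs (norm_zeroExt_le c) ε x z).1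
  · refine tendsto_eLpNorm_of_bounded (C := m * (4 * ‖c‖)) hp0 hp ?_ ?_ ?_
    · filter_upwards [self_mem_nhdsWithin] with ε hε
      exact (hm ε hε).2.measurable_bondInt (measurable_shortDefect hΩm hs hφm ε)
    · filter_upwards [self_mem_nhdsWithin] with ε hε x
      exact ((hm ε hε).2.bondInt_bounded (measurable_shortDefect hΩm hs hφm ε)
        (mul_nonneg zero_le_four (norm_nonneg c))
        fun z _ => norm_shortDefect_le (norm_zeroExt_le c) ε x z).1
    · filter_upwards [ae_restrict_mem hΩm] with x hx
      exact tendsto_bondInt_shortDefect M hΩ hs hφm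
        ((continuousOn_zeroExt c).mono subset_closure) hx

end Consistency

end Peridynamics

namespace Peridynamics

/-! ### Equibounded operators and a second-order Grönwall estimate -/

section Abstract

variable {X Z : Type*} [NormedAddCommGroup X] [NormedSpace ℝ X] [NormedAddCommGroup Z]
  [NormedSpace ℝ Z]

lemma isClosed_setOf_tendsto_zero {R : ℝ → X →L[ℝ] Z} {l : Filter ℝ} {C : ℝ}
    (h : ∀ᶠ ε in l, ∀ w, ‖R ε w‖ ≤ C * ‖w‖) :
    IsClosed {w | Tendsto (fun ε => R ε w) l (𝓝 0)} := by
  refine isClosed_of_closure_subset fun w hw => ?_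
  change Tendsto (fun ε => R ε w) l (𝓝 0)
  rw [Metric.tendsto_nhds]
  intro η hη
  -- `|C| + 1` stands in for `C`, whose sign is unknown; the approximation then costs at most η/2.
  obtain ⟨w', hw', hd⟩ := Metric.mem_closure_iff.1 hw (η / (2 * (|C| + 1))) (by positivity)
  filter_upwards [h, Metric.tendsto_nhds.1 hw' (η / 2) (by positivity)] with ε h1 h2
  rw [dist_zero_right] at h2 ⊢
  have h3 : ‖R ε (w - w')‖ ≤ η / 2 := by
    rw [dist_eq_norm, lt_div_iff₀ (by positivity)] at hd
    have := h1 (w - w')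
    nlinarith [le_abs_self C, norm_nonneg (w - w'), abs_nonneg C]
  calc ‖R ε w‖ = ‖R ε (w - w') + R ε w'‖ := by rw [map_sub, sub_add_cancel]
    _ ≤ ‖R ε (w - w')‖ + ‖R ε w'‖ := norm_add_le _ _
    _ < η := by linarith

/-- A finite net reduces uniformity over `K` to finitely many pointwise limits, and equiboundedness
covers the rest. It yields uniformity in time along the two-scale solution. -/
lemma eventually_norm_le_of_isCompact {R : ℝ → X →L[ℝ] Z} {l : Filter ℝ} {C : ℝ}
    (h : ∀ᶠ ε in l, ∀ w, ‖R ε w‖ ≤ C * ‖w‖) (hR : ∀ w, Tendsto (fun ε => R ε w) l (𝓝 0))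
    {K : Set X} (hK : IsCompact K) {η : ℝ} (hη : 0 < η) : ∀ᶠ ε in l, ∀ w ∈ K, ‖R ε w‖ ≤ η := by
  obtain ⟨t, -, htf, ht⟩ := hK.finite_cover_balls
    (show 0 < η / (2 * (|C| + 1)) by positivity)
  have hfin : ∀ᶠ ε in l, ∀ w' ∈ t, ‖R ε w'‖ < η / 2 := by
    rw [htf.eventually_all]
    intro w' _
    have := Metric.tendsto_nhds.1 (hR w') (η / 2) (by positivity)
    exact this.mono fun ε h => by rwa [dist_zero_right] at h
  filter_upwards [h, hfin] with ε h1 h2 w hw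
  obtain ⟨w', hw', hd⟩ := mem_iUnion₂.1 (ht hw)
  rw [Metric.mem_ball] at hd
  have h3 : ‖R ε (w - w')‖ ≤ η / 2 := by
    rw [dist_eq_norm, lt_div_iff₀ (by positivity)] at hd
    have := h1 (w - w')
    nlinarith [le_abs_self C, norm_nonneg (w - w'), abs_nonneg C]
  calc ‖R ε w‖ = ‖R ε (w - w') + R ε w'‖ := by rw [map_sub, sub_add_cancel]
    _ ≤ ‖R ε (w - w')‖ + ‖R ε w'‖ := norm_add_le _ _
    _ ≤ η := by linarith [h2 w' hw']

/-- Grönwall's inequality for a second-order equation with zero initial data. -/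
lemma norm_le_gronwallBound_of_second_order {e e₁ e₂ : ℝ → Z} {T K η : ℝ} (hK : 1 ≤ K)
    (hη : 0 ≤ η) (h₁ : ∀ t ∈ Icc 0 T, HasDerivWithinAt e (e₁ t) (Icc 0 T) t)
    (h₂ : ∀ t ∈ Icc 0 T, HasDerivWithinAt e₁ (e₂ t) (Icc 0 T) t)
    (h0 : e 0 = 0) (h0' : e₁ 0 = 0) (hb : ∀ t ∈ Icc 0 T, ‖e₂ t‖ ≤ K * ‖e t‖ + η) :
    ∀ t ∈ Icc 0 T, ‖e t‖ ≤ gronwallBound 0 K η t := by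
  intro t ht
  -- The first-order system for (e, e₁), in the maximum norm. The hypothesis 1 ≤ K lets the same
  -- bound cover the component e' = e₁.
  have hd : ∀ t ∈ Icc 0 T, HasDerivWithinAt (fun s => (e s, e₁ s)) (e₁ t, e₂ t) (Icc 0 T) t :=
    fun t ht => (h₁ t ht).prodMk (h₂ t ht)
  have h := norm_le_gronwallBound_of_norm_deriv_right_le (f := fun s => (e s, e₁ s))
    (f' := fun s => (e₁ s, e₂ s)) (δ := 0) (K := K) (ε := η)
    (fun t ht => (hd t ht).continuousWithinAt) (fun t ht => ?_) (by simp [h0, h0']) (fun t ht => ?_)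
    t ht
  · rw [sub_zero] at h
    exact (norm_fst_le (e t, e₁ t)).trans h
  · exact (hd t ⟨ht.1, ht.2.le⟩).mono_of_mem_nhdsWithin
      (Icc_mem_nhdsGE_of_mem ⟨ht.1, ht.2⟩)
  · have hn1 := norm_fst_le (e t, e₁ t)
    have hn2 := norm_snd_le (e t, e₁ t)
    have hn0 := norm_nonneg (e t, e₁ t)
    rw [Prod.norm_mk]
    simp only at hn1 hn2
    refine max_le ?_ ((hb t ⟨ht.1, ht.2.le⟩).trans ?_)
    · nlinarith
    · nlinarith

/-- Strong convergence to zero of a bounded family of operators on `L^p` can be tested on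
indicator functions. -/
lemma Lp_tendsto_zero_of_indicator {α E : Type*} [MeasurableSpace α] {μ : Measure α}
    [NormedAddCommGroup E] [NormedSpace ℝ E] {p : ℝ≥0∞} [Fact (1 ≤ p)] (hp : p ≠ ∞)
    {R : ℝ → Lp E p μ →L[ℝ] Z} {l : Filter ℝ} {C : ℝ}
    (h : ∀ᶠ ε in l, ∀ w, ‖R ε w‖ ≤ C * ‖w‖)
    (hind : ∀ (c : E) {s : Set α} (hs : MeasurableSet s) (hμs : μ s < ∞),
      Tendsto (fun ε => R ε (Lp.simpleFunc.indicatorConst p hs hμs.ne c : Lp E p μ)) l (𝓝 0))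
    (w : Lp E p μ) : Tendsto (fun ε => R ε w) l (𝓝 0) := by
  refine Lp.induction hp (fun w => Tendsto (fun ε => R ε w) l (𝓝 0)) hind
    (fun f g hf hg _ h1 h2 => ?_) (isClosed_setOf_tendsto_zero h) w
  have := h1.add h2
  rw [add_zero] at this
  exact this.congr fun ε => (map_add (R ε) _ _).symm

end Abstract

/-! ### Operators at scale ε and their consistency -/

section Operators

variable (M : Medium) {Ω : Set E3} {p : ℝ≥0∞} [Fact (1 ≤ p)]

/-- The evaluation `S` at `y = x / ε`, and the bounded operators of the heterogeneous problem (`A`)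
and of the two-scale problem evaluated at `y = x / ε` (`B`). -/
structure IsScaleOperators (C ε : ℝ) (S : TwoScale Ω p →L[ℝ] LpVec Ω p)
    (A : LpVec Ω p →L[ℝ] LpVec Ω p) (B : TwoScale Ω p →L[ℝ] LpVec Ω p) : Prop where
  eval : ∀ w, S w =ᵐ[volume.restrict Ω] fun x => perVal w x (ε⁻¹ • x)
  hetero : ∀ v, A v =ᵐ[volume.restrict Ω]
    bondInt (longKernel M ε) (dispField Ω v) + bondInt (shortKernel M ε) (dispField Ω v)
  twoScale : ∀ w, B w =ᵐ[volume.restrict Ω]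
    bondInt (longKernel M ε) (dispAverage ε w) + bondInt (shortKernel M ε) (dispFast ε w)
  norm_hetero_le : ∀ v, ‖A v‖ ≤ C * ‖v‖
  norm_defect_le : ∀ w, ‖(A ∘L S - B) w‖ ≤ C * ‖w‖

omit [Fact (1 ≤ p)] in
lemma coeFn_add_ae_eq {f g : LpVec Ω p} {f' g' : E3 → E3} (hf : f =ᵐ[volume.restrict Ω] f')
    (hg : g =ᵐ[volume.restrict Ω] g') : (f + g : LpVec Ω p) =ᵐ[volume.restrict Ω] f' + g' :=
  (Lp.coeFn_add f g).trans (hf.add hg)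

lemma exists_isScaleOperators (hp : p ≠ ∞) (hΩ : MeasurableSet Ω) (hb : Bornology.IsBounded Ω) :
    ∃ C : ℝ, ∀ ε : ℝ, 0 < ε → ε ≤ 1 → ∃ (S : TwoScale Ω p →L[ℝ] LpVec Ω p)
      (A : LpVec Ω p →L[ℝ] LpVec Ω p) (B : TwoScale Ω p →L[ℝ] LpVec Ω p),
      IsScaleOperators M C ε S A B := by
  obtain ⟨m, hm0, hm⟩ := exists_isBondKernel M
  obtain ⟨CS, hCS0, hS⟩ := exists_clm_perVal (Ω := Ω) (p := p) hp hb
  obtain ⟨CB, hCB0, hB⟩ := exists_bound_disp (Ω := Ω) (p := p) hp hb hΩ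
  -- The heterogeneous operator has norm at most 4m (two kernels, 2m each), its composition with the
  -- trace 4m·CS, and the two-scale operator 2m·CB. The sum serves both required bounds.
  refine ⟨4 * m + 4 * m * CS + 2 * (m * CB), fun ε hε hε1 => ?_⟩
  obtain ⟨S, hS1, hS2⟩ := hS ε hε hε1
  obtain ⟨A₁, hA₁, hA₁'⟩ := exists_clm_dispField (Ω := Ω) (p := p) (hm ε hε).1 hm0 hp hΩ
  obtain ⟨A₂, hA₂, hA₂'⟩ := exists_clm_dispField (Ω := Ω) (p := p) (hm ε hε).2 hm0 hp hΩ
  obtain ⟨B₁, hB₁, hB₁'⟩ := exists_clm_dispAverage (hm ε hε).1 hm0 hp hΩ hCB0 hε hε1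
    fun w z => (hB ε hε hε1 w z).1
  obtain ⟨B₂, hB₂, hB₂'⟩ := exists_clm_dispFast (hm ε hε).2 hm0 hp hCB0 hε hε1
    fun w z => (hB ε hε hε1 w z).2
  have hA : ∀ v, ‖(A₁ + A₂) v‖ ≤ (4 * m) * ‖v‖ := fun v =>
    (norm_add_le (A₁ v) (A₂ v)).trans (by linarith [hA₁' v, hA₂' v])
  have hB : ∀ w, ‖(B₁ + B₂) w‖ ≤ (2 * (m * CB)) * ‖w‖ := fun w =>
    (norm_add_le (B₁ w) (B₂ w)).trans (by linarith [hB₁' w, hB₂' w])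
  refine ⟨S, A₁ + A₂, B₁ + B₂, hS1, fun v => coeFn_add_ae_eq (hA₁ v) (hA₂ v),
    fun w => coeFn_add_ae_eq (hB₁ w) (hB₂ w), fun v => (hA v).trans ?_, fun w => ?_⟩
  · have h7 : 0 ≤ 4 * m * CS := by positivity
    have h8 : 0 ≤ 2 * (m * CB) := by positivity
    exact mul_le_mul_of_nonneg_right (by linarith) (norm_nonneg v)
  · refine (norm_sub_le ((A₁ + A₂) (S w)) ((B₁ + B₂) w)).trans ?_
    have h7 : ‖(A₁ + A₂) (S w)‖ ≤ 4 * m * (CS * ‖w‖) :=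
      (hA _).trans (mul_le_mul_of_nonneg_left (hS2 w) (by positivity))
    have h8 : 0 ≤ 4 * m * ‖w‖ := by positivity
    linarith [hB w]

/-- The values at x cancel, and the cell average of a product field replaces the indicator by its
mean; only the oscillation about the mean survives. -/
lemma bondInt_dispField_sub_dispAverage (hp : p ≠ ∞) (hΩ : MeasurableSet Ω)
    (hb : Bornology.IsBounded Ω) {ε : ℝ} (hε : 0 < ε) (hε1 : ε ≤ 1) {w : TwoScale Ω p} {s : Set E3}
    {c : closure Ω →ᵇ E3} (hw : IsProductField w s c) {v : LpVec Ω p}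
    (hv : v =ᵐ[volume.restrict Ω] fun x => perVal w x (ε⁻¹ • x)) :
    ∀ᵐ x ∂(volume.restrict Ω), bondInt (longKernel M ε) (dispField Ω v) x -
      bondInt (longKernel M ε) (dispAverage ε w) x =
        bondInt (longKernel M ε) (longDefect Ω s (zeroExt c) ε) x := by
  obtain ⟨m, hm0, hm⟩ := exists_isBondKernel M
  obtain ⟨CB, hCB0, hB⟩ := exists_bound_disp (Ω := Ω) (p := p) hp hb hΩ
  refine bondInt_sub_ae
    ((hm ε hε).1.bondInt_Lp Fact.out hp (measurable_dispField hΩ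
      (Lp.stronglyMeasurable v).measurable) (eLpNorm_dispField_le hΩ v)).2
    ((hm ε hε).1.bondInt_Lp Fact.out hp (measurable_dispAverage hΩ ε w)
      fun z => (hB ε hε hε1 w z).1).2 ?_
  filter_upwards [hv, ae_ae_add_of_restrict hΩ hv,
    ae_restrict_of_ae (ae_ae_add (hw.scaled hε hε1))] with x h1 h2 h3
  filter_upwards [h2, h3] with z h2 h3
  by_cases h : x + z ∈ Ω
  · simp only [dispField, dispAverage, longDefect, indicator_of_mem h, h1, h2 h, h3,
      hw.cellAverage_eq, sub_smul]
    abel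
  · simp only [dispField, dispAverage, longDefect, indicator_of_notMem h, sub_zero]

lemma bondInt_dispField_sub_dispFast (hp : p ≠ ∞) (hΩ : MeasurableSet Ω)
    (hb : Bornology.IsBounded Ω) {ε : ℝ} (hε : 0 < ε) (hε1 : ε ≤ 1) {w : TwoScale Ω p} {s : Set E3}
    {c : closure Ω →ᵇ E3} (hw : IsProductField w s c) {v : LpVec Ω p}
    (hv : v =ᵐ[volume.restrict Ω] fun x => perVal w x (ε⁻¹ • x)) :
    ∀ᵐ x ∂(volume.restrict Ω), bondInt (shortKernel M ε) (dispField Ω v) x -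
      bondInt (shortKernel M ε) (dispFast ε w) x =
        bondInt (shortKernel M ε) (shortDefect Ω s (zeroExt c) ε) x := by
  obtain ⟨m, hm0, hm⟩ := exists_isBondKernel M
  obtain ⟨CB, hCB0, hB⟩ := exists_bound_disp (Ω := Ω) (p := p) hp hb hΩ
  refine bondInt_sub_ae
    ((hm ε hε).2.bondInt_Lp Fact.out hp (measurable_dispField hΩ
      (Lp.stronglyMeasurable v).measurable) (eLpNorm_dispField_le hΩ v)).2
    ((hm ε hε).2.bondInt_Lp Fact.out hp (measurable_dispFast ε w)
      fun z => (hB ε hε hε1 w z).2).2 ?_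
  filter_upwards [hv, ae_ae_add_of_restrict hΩ hv, ae_restrict_of_ae (hw.scaled hε hε1),
    ae_restrict_of_ae (ae_ae_add (hw.scaled hε hε1))] with x h1 h2 h3 h4
  filter_upwards [h2, h4] with z h2 h4
  by_cases h : x + z ∈ Ω
  · simp only [dispField, dispFast, shortDefect, indicator_of_mem h, h1, h2 h, h3, h4]
  · simp only [dispField, dispFast, shortDefect, indicator_of_notMem h, h3, h4]

lemma eventually_scale : ∀ᶠ ε : ℝ in 𝓝[>] 0, 0 < ε ∧ ε ≤ 1 := by
  filter_upwards [self_mem_nhdsWithin, mem_nhdsWithin_of_mem_nhds (Iic_mem_nhds zero_lt_one)]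
    with ε h1 h2 using ⟨h1, h2⟩

lemma tendsto_consistency_error_of_product (hp : p ≠ ∞) (hΩ : IsOpen Ω)
    (hb : Bornology.IsBounded Ω)
    {C : ℝ} {S : ℝ → TwoScale Ω p →L[ℝ] LpVec Ω p} {A : ℝ → LpVec Ω p →L[ℝ] LpVec Ω p}
    {B : ℝ → TwoScale Ω p →L[ℝ] LpVec Ω p}
    (h : ∀ ε : ℝ, 0 < ε → ε ≤ 1 → IsScaleOperators M C ε (S ε) (A ε) (B ε)) {w : TwoScale Ω p}
    {s : Set E3} (hs : MeasurableSet s) {c : closure Ω →ᵇ E3} (hw : IsProductField w s c) :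
    Tendsto (fun ε => (A ε ∘L S ε - B ε) w) (𝓝[>] 0) (𝓝 0) := by
  have hΩm := hΩ.measurableSet
  obtain ⟨hL, hS⟩ := tendsto_eLpNorm_defect (p := p) M hp hΩ hb hs c
  have hsum := hL.add hS
  rw [add_zero] at hsum
  rw [tendsto_zero_iff_enorm_tendsto_zero]
  refine tendsto_of_tendsto_of_tendsto_of_le_of_le' tendsto_const_nhds hsum
    (Eventually.of_forall fun _ => zero_le) ?_
  filter_upwards [eventually_scale] with ε hε
  obtain ⟨h1, h2, h3, -, -⟩ := h ε hε.1 hε.2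
  obtain ⟨m, hm0, hm⟩ := exists_isBondKernel M
  have hae : ((A ε ∘L S ε - B ε) w : LpVec Ω p) =ᵐ[volume.restrict Ω]
      bondInt (longKernel M ε) (longDefect Ω s (zeroExt c) ε) +
        bondInt (shortKernel M ε) (shortDefect Ω s (zeroExt c) ε) := by
    change ((A ε (S ε w) - B ε w : LpVec Ω p) : E3 → E3) =ᵐ[volume.restrict Ω] _
    filter_upwards [Lp.coeFn_sub (A ε (S ε w)) (B ε w), h2 (S ε w), h3 w,
      bondInt_dispField_sub_dispAverage M hp hΩm hb hε.1 hε.2 hw (h1 w),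
      bondInt_dispField_sub_dispFast M hp hΩm hb hε.1 hε.2 hw (h1 w)] with x a1 a2 a3 a4 a5
    rw [a1, Pi.sub_apply, a2, a3, Pi.add_apply, Pi.add_apply, Pi.add_apply, ← a4, ← a5]
    abel
  rw [Lp.enorm_def, eLpNorm_congr_ae hae]
  exact eLpNorm_add_le
    ((hm ε hε.1).1.measurable_bondInt (measurable_longDefect hΩm hs
      (measurable_zeroExt c) ε)).aestronglyMeasurable
    ((hm ε hε.1).2.measurable_bondInt (measurable_shortDefect hΩm hs
      (measurable_zeroExt c) ε)).aestronglyMeasurable Fact.out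

/-- Consistency: the heterogeneous operator applied to `w(x, x/ε)` differs from the two-scale
operator by an error that vanishes in the limit. -/
lemma tendsto_consistency_error (hp : p ≠ ∞) (hΩ : IsOpen Ω) (hb : Bornology.IsBounded Ω)
    {C : ℝ} {S : ℝ → TwoScale Ω p →L[ℝ] LpVec Ω p} {A : ℝ → LpVec Ω p →L[ℝ] LpVec Ω p}
    {B : ℝ → TwoScale Ω p →L[ℝ] LpVec Ω p}
    (h : ∀ ε : ℝ, 0 < ε → ε ≤ 1 → IsScaleOperators M C ε (S ε) (A ε) (B ε)) (w : TwoScale Ω p) :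
    Tendsto (fun ε => (A ε ∘L S ε - B ε) w) (𝓝[>] 0) (𝓝 0) := by
  refine Lp_tendsto_zero_of_indicator hp (R := fun ε => A ε ∘L S ε - B ε)
    (eventually_scale.mono fun ε hε => (h ε hε.1 hε.2).norm_defect_le) (fun c s hs hμs => ?_) w
  exact tendsto_consistency_error_of_product M hp hΩ hb h hs (isProductField_indicatorConst hs hμs.ne c)

end Operators

end Peridynamics

namespace Peridynamics

/-! ### From the two initial value problems to the error estimate -/

section Equations

/-- Substitution x' = x + z. Off the domain either the kernel or the displacement may vanish, so the
horizon can sit in the kernel and the cut-off to Ω in the displacement. -/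
lemma smul_setIntegral_bond_eq {s : Set E3} (hs : MeasurableSet s) {x : E3} {r : ℝ} {c k : E3 → ℝ}
    {f g : E3 → E3} (h1 : ∀ z, x + z ∈ s → r * c (x + z) = k z ∧ f (x + z) = g z)
    (h2 : ∀ z, x + z ∉ s → k z • bond z (g z) = 0) :
    r • ∫ x' in s, c x' • bond (x' - x) (f x') = ∫ z, k z • bond z (g z) := by
  rw [← integral_indicator hs, ← integral_add_left_eq_self _ x, ← integral_smul]
  refine integral_congr_ae (Eventually.of_forall fun z => ?_)
  by_cases hz : x + z ∈ s
  · simp only [indicator_of_mem hz, add_sub_cancel_left, smul_smul, (h1 z hz).1, (h1 z hz).2]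
  · simp only [indicator_of_notMem hz, smul_zero, h2 z hz]

variable (M : Medium) {Ω : Set E3} {p : ℝ≥0∞}

lemma long_integral_eq (hΩ : MeasurableSet Ω) (ε : ℝ) (x : E3) (f : E3 → E3) :
    (M.ρ (ε⁻¹ • x))⁻¹ • ∫ x' in Metric.closedBall x M.γ ∩ Ω, M.lam • bond (x' - x) (f x') =
      ∫ z, longKernel M ε x z • bond z (Ω.indicator f (x + z)) := by
  refine smul_setIntegral_bond_eq (measurableSet_closedBall.inter hΩ) (c := fun _ => M.lam)
    (fun z hz => ?_) (fun z hz => ?_)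
  · have hz' : ‖z‖ ≤ M.γ := by simpa [dist_eq_norm] using hz.1
    simp only [longKernel, if_pos hz', indicator_of_mem hz.2, and_self]
  · by_cases h : x + z ∈ Ω
    · have hz' : ¬ ‖z‖ ≤ M.γ := fun h' => hz ⟨by simpa [dist_eq_norm] using h', h⟩
      simp only [longKernel, if_neg hz', zero_smul]
    · simp only [indicator_of_notMem h, bond_zero, smul_zero]

lemma short_integral_eq (hΩ : MeasurableSet Ω) (ε : ℝ) (x : E3) (f : E3 → E3) :
    (M.ρ (ε⁻¹ • x))⁻¹ • ∫ x' in Metric.ball x (ε * M.δ) ∩ Ω,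
        ((1 / ε ^ 2) * M.α (ε⁻¹ • x) (ε⁻¹ • x')) • bond (x' - x) (f x') =
      ∫ z, shortKernel M ε x z • bond z (Ω.indicator f (x + z)) := by
  refine smul_setIntegral_bond_eq (measurableSet_ball.inter hΩ)
    (c := fun x' => (1 / ε ^ 2) * M.α (ε⁻¹ • x) (ε⁻¹ • x')) (fun z hz => ?_) (fun z hz => ?_)
  · have hz' : ‖z‖ < ε * M.δ := by simpa [dist_eq_norm] using hz.1
    simp only [shortKernel, if_pos hz', indicator_of_mem hz.2, and_self]
  · by_cases h : x + z ∈ Ω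
    · have hz' : ¬ ‖z‖ < ε * M.δ := fun h' => hz ⟨by simpa [dist_eq_norm] using h', h⟩
      simp only [shortKernel, if_neg hz', zero_smul]
    · simp only [indicator_of_notMem h, bond_zero, smul_zero]

lemma bond_inv_smul {ε : ℝ} (hε : 0 < ε) (z η : E3) : bond (ε⁻¹ • z) η = ε • bond z η := by
  have h : ‖ε⁻¹ • z‖ = ε⁻¹ * ‖z‖ := by
    rw [norm_smul, Real.norm_of_nonneg (inv_nonneg.2 hε.le)]
  rw [bond, bond, h, inner_smul_left, smul_smul, smul_smul]
  congr 1
  rcases eq_or_ne z 0 with rfl | hz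
  · simp
  · have : ‖z‖ ≠ 0 := norm_ne_zero_iff.2 hz
    simp only [conj_trivial]
    field_simp

/-- Rescaling z by 1/ε gives a Jacobian ε⁻³, and the bond, homogeneous of degree -1, gives ε.
Together they produce exactly the factor 1/ε² of the heterogeneous short-range kernel. -/
lemma fast_integral_eq {ε : ℝ} (hε : 0 < ε) (x : E3) (w : TwoScale Ω p) :
    (M.ρ (ε⁻¹ • x))⁻¹ • ∫ y' in Metric.ball (cellRep (ε⁻¹ • x)) M.δ,
        M.α (cellRep (ε⁻¹ • x)) y' • bond (y' - cellRep (ε⁻¹ • x))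
          (perVal w x y' - perVal w x (cellRep (ε⁻¹ • x))) =
      bondInt (shortKernel M ε) (dispFast ε w) x := by
  set y := ε⁻¹ • x with hy
  set k : E3 → ℝ := fun z => if ‖z‖ < M.δ then (M.ρ y)⁻¹ * M.α y (y + z) else 0 with hk
  set g : E3 → E3 := fun z => perVal w x (y + z) - perVal w x y with hg
  rw [smul_setIntegral_bond_eq (k := k) (g := g) measurableSet_ball]
  · have h := Measure.integral_comp_inv_smul (volume : Measure E3) (fun z => k z • bond z (g z)) ε
    have hf : Module.finrank ℝ E3 = 3 := by simp
    rw [hf, abs_of_pos (by positivity)] at h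
    have h' : ∫ z, k z • bond z (g z) =
        (ε ^ 3)⁻¹ • ∫ z, k (ε⁻¹ • z) • bond (ε⁻¹ • z) (g (ε⁻¹ • z)) := by
      rw [h, inv_smul_smul₀ (by positivity)]
    rw [h', ← integral_smul]
    unfold bondInt
    refine integral_congr_ae (Eventually.of_forall fun z => ?_)
    have hnorm : ‖ε⁻¹ • z‖ = ε⁻¹ * ‖z‖ := by
      rw [norm_smul, Real.norm_of_nonneg (inv_nonneg.2 hε.le)]
    simp only [hk, hg, hnorm, inv_mul_lt_iff₀ hε, shortKernel, dispFast, ← hy, smul_add,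
      bond_inv_smul hε, smul_smul]
    congr 1
    split_ifs
    · field_simp
    · simp
  · intro z hz
    have hz' : ‖z‖ < M.δ := by simpa [dist_eq_norm] using hz
    simp only [hk, hg, if_pos hz', M.α_cellRep, perVal_cellRep_add, perVal_cellRep, and_self]
  · intro z hz
    have hz' : ¬ ‖z‖ < M.δ := fun h' => hz (by simpa [dist_eq_norm] using h')
    simp only [hk, if_neg hz', zero_smul]

variable [Fact (1 ≤ p)] {T : ℝ} {u₀ v₀ : TwoScale Ω p} {b : ℝ → TwoScale Ω p} {ε C : ℝ}
  {S : TwoScale Ω p →L[ℝ] LpVec Ω p} {A : LpVec Ω p →L[ℝ] LpVec Ω p}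
  {B : TwoScale Ω p →L[ℝ] LpVec Ω p}

lemma hetero_equation (hΩ : MeasurableSet Ω) (hop : IsScaleOperators M C ε S A B)
    {u : ℝ → LpVec Ω p} (hu : IsPeridynamicSolution M Ω p T u₀ v₀ b ε u) {t : ℝ}
    (ht : t ∈ Icc 0 T) :
    ∀ᵐ x ∂(volume.restrict Ω), iteratedDerivWithin 2 u (Icc 0 T) t x =
      A (u t) x + (M.ρ (ε⁻¹ • x))⁻¹ • perVal (b t) x (ε⁻¹ • x) := by
  filter_upwards [hu.equation t ht, hop.hetero (u t)] with x h1 h2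
  rw [h2, Pi.add_apply]
  have h3 := congrArg (fun ξ => (M.ρ (ε⁻¹ • x))⁻¹ • ξ) h1
  simp only [inv_smul_smul₀ (M.ρ_pos _).ne', smul_add] at h3
  rw [h3, long_integral_eq M hΩ ε x (fun x' => u t x' - u t x),
    short_integral_eq M hΩ ε x (fun x' => u t x' - u t x)]
  rfl

/-- The two-scale equation holds for every x in Ω off one null set of y, hence may be read at y =
x/ε for almost every x. -/
lemma twoScale_equation (hΩ : MeasurableSet Ω) (hε : 0 < ε) (hε1 : ε ≤ 1)
    (hop : IsScaleOperators M C ε S A B)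
    {u : ℝ → TwoScale Ω p} (hu : IsTwoScaleSolution M Ω p T u₀ v₀ b u) {t : ℝ}
    (ht : t ∈ Icc 0 T) :
    ∀ᵐ x ∂(volume.restrict Ω), S (iteratedDerivWithin 2 u (Icc 0 T) t) x =
      B (u t) x + (M.ρ (ε⁻¹ • x))⁻¹ • perVal (b t) x (ε⁻¹ • x) := by
  filter_upwards [ae_restrict_of_ae (ae_cellRep (hu.equation t ht) hε hε1), hop.twoScale (u t),
    hop.eval (iteratedDerivWithin 2 u (Icc 0 T) t), ae_restrict_mem hΩ] with x h1 h2 h3 hx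
  rw [h2, h3, Pi.add_apply]
  have h4 := congrArg (fun ξ => (M.ρ (ε⁻¹ • x))⁻¹ • ξ) (h1 x hx)
  rw [M.ρ_cellRep] at h4
  simp only [inv_smul_smul₀ (M.ρ_pos _).ne', smul_add] at h4
  rw [fast_integral_eq M hε, long_integral_eq M hΩ] at h4
  simp only [perVal_cellRep] at h4
  rw [h4]
  rfl

lemma norm_error_le (hΩ : MeasurableSet Ω) (hT : 0 < T) (hε : 0 < ε) (hε1 : ε ≤ 1)
    (hop : IsScaleOperators M C ε S A B)
    {uε : ℝ → LpVec Ω p} (huε : IsPeridynamicSolution M Ω p T u₀ v₀ b ε uε)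
    {u : ℝ → TwoScale Ω p} (hu : IsTwoScaleSolution M Ω p T u₀ v₀ b u) {η : ℝ} (hη : 0 ≤ η)
    (hR : ∀ t ∈ Icc 0 T, ‖(A ∘L S - B) (u t)‖ ≤ η) :
    ∀ t ∈ Icc 0 T, ‖uε t - S (u t)‖ ≤ gronwallBound 0 (max C 1) η t := by
  have hd : ∀ {X : Type} [NormedAddCommGroup X] [NormedSpace ℝ X] {f : ℝ → X},
      ContDiffOn ℝ 2 f (Icc 0 T) → ∀ t ∈ Icc 0 T,
        HasDerivWithinAt f (derivWithin f (Icc 0 T) t) (Icc 0 T) t ∧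
        HasDerivWithinAt (derivWithin f (Icc 0 T)) (iteratedDerivWithin 2 f (Icc 0 T) t)
          (Icc 0 T) t := by
    intro X _ _ f hf t ht
    have hU := uniqueDiffOn_Icc hT
    refine ⟨(hf.differentiableOn two_ne_zero t ht).hasDerivWithinAt, ?_⟩
    have h1 : DifferentiableOn ℝ (derivWithin f (Icc 0 T)) (Icc 0 T) :=
      (hf.derivWithin hU (m := 1) (by norm_num)).differentiableOn one_ne_zero
    rw [iteratedDerivWithin_succ, iteratedDerivWithin_one]
    exact (h1 t ht).hasDerivWithinAt
  refine norm_le_gronwallBound_of_second_order (le_max_right C 1) hη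
    (e₁ := fun t => derivWithin uε (Icc 0 T) t - S (derivWithin u (Icc 0 T) t))
    (e₂ := fun t => iteratedDerivWithin 2 uε (Icc 0 T) t - S (iteratedDerivWithin 2 u (Icc 0 T) t))
    (fun t ht => ?_) (fun t ht => ?_) ?_ ?_ fun t ht => ?_
  · exact (hd huε.contDiffOn t ht).1.sub
      (S.hasFDerivAt.comp_hasDerivWithinAt t (hd hu.contDiffOn t ht).1)
  · exact (hd huε.contDiffOn t ht).2.sub
      (S.hasFDerivAt.comp_hasDerivWithinAt t (hd hu.contDiffOn t ht).2)
  · rw [sub_eq_zero, hu.initial]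
    exact Lp.ext (EventuallyEq.trans huε.initial (hop.eval u₀).symm)
  · rw [sub_eq_zero, hu.initial_deriv]
    exact Lp.ext (EventuallyEq.trans huε.initial_deriv (hop.eval v₀).symm)
  · have heq : iteratedDerivWithin 2 uε (Icc 0 T) t - S (iteratedDerivWithin 2 u (Icc 0 T) t) =
        A (uε t) - B (u t) := by
      refine Lp.ext ?_
      filter_upwards [Lp.coeFn_sub (iteratedDerivWithin 2 uε (Icc 0 T) t)
        (S (iteratedDerivWithin 2 u (Icc 0 T) t)), Lp.coeFn_sub (A (uε t)) (B (u t)),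
        hetero_equation M hΩ hop huε ht, twoScale_equation M hΩ hε hε1 hop hu ht]
        with x h1 h2 h3 h4
      rw [h1, h2, Pi.sub_apply, Pi.sub_apply, h3, h4, add_sub_add_right_eq_sub]
    -- Stability acts on the first summand, consistency on the second.
    have hsplit : A (uε t) - B (u t) = A (uε t - S (u t)) + (A ∘L S - B) (u t) := by
      change _ = A (uε t - S (u t)) + (A (S (u t)) - B (u t))
      rw [map_sub]; abel
    rw [heq, hsplit]
    refine (norm_add_le _ _).trans (add_le_add ((hop.norm_hetero_le _).trans ?_) (hR t ht))
    exact mul_le_mul_of_nonneg_right (le_max_left C 1) (norm_nonneg _)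

end Equations

end Peridynamics

/-! ### The convergence theorem -/

open Peridynamics
/-- The set `E` collects the scales under consideration, for instance all `ε > 0`,
or `ε = 1/n` with `n ≥ 1`. -/
theorem theorem3p12 (M : Medium) (Ω : Set E3) (hΩ_open : IsOpen Ω)
    (hΩ_bdd : Bornology.IsBounded Ω) (p : ℝ≥0∞) [Fact (1 ≤ p)] (hp : 3 / 2 < p) (hp' : p < ∞)
    (T : ℝ) (hT : 0 < T) (u₀ v₀ : TwoScale Ω p) (b : ℝ → TwoScale Ω p)
    (hb : ContinuousOn b (Icc 0 T))
    (E : Set ℝ) (hE : E ⊆ Ioi 0) (uε : ℝ → ℝ → LpVec Ω p)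
    (huε : ∀ ε ∈ E, IsPeridynamicSolution M Ω p T u₀ v₀ b ε (uε ε))
    (u : ℝ → TwoScale Ω p) (hu : IsTwoScaleSolution M Ω p T u₀ v₀ b u) :
    ∀ t ∈ Icc 0 T,
      Tendsto (fun ε => eLpNorm (fun x => uε ε t x - perVal (u t) x (ε⁻¹ • x)) p (volume.restrict Ω))
        (𝓝[E] 0) (𝓝 0) := by
  intro t ht
  have hΩ := hΩ_open.measurableSet
  obtain ⟨C, hC⟩ := exists_isScaleOperators M (p := p) hp'.ne hΩ hΩ_bdd
  -- Operators are chosen for every real ε, with zero as a default outside (0, 1], so that they form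
  -- families indexed by ℝ.
  have hC' : ∀ ε : ℝ, ∃ (S : TwoScale Ω p →L[ℝ] LpVec Ω p) (A : LpVec Ω p →L[ℝ] LpVec Ω p)
      (B : TwoScale Ω p →L[ℝ] LpVec Ω p), 0 < ε → ε ≤ 1 → IsScaleOperators M C ε S A B := by
    intro ε
    by_cases h : 0 < ε ∧ ε ≤ 1
    · obtain ⟨S, A, B, hop⟩ := hC ε h.1 h.2
      exact ⟨S, A, B, fun _ _ => hop⟩
    · exact ⟨0, 0, 0, fun h1 h2 => absurd ⟨h1, h2⟩ h⟩
  choose S A B hop using hC'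
  have hcompact : IsCompact (u '' Icc 0 T) := isCompact_Icc.image_of_continuousOn
    hu.contDiffOn.continuousOn
  have hsmall : ∀ η : ℝ, 0 < η → ∀ᶠ ε in 𝓝[>] 0, ∀ w ∈ u '' Icc 0 T,
      ‖(A ε ∘L S ε - B ε) w‖ ≤ η := fun η hη =>
    eventually_norm_le_of_isCompact (R := fun ε => A ε ∘L S ε - B ε)
      (eventually_scale.mono fun ε hε => (hop ε hε.1 hε.2).norm_defect_le)
      (tendsto_consistency_error M hp'.ne hΩ_open hΩ_bdd hop) hcompact hη
  have hle : 𝓝[E] (0 : ℝ) ≤ 𝓝[>] 0 := nhdsWithin_mono 0 hE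
  have hnorm : Tendsto (fun ε => uε ε t - S ε (u t)) (𝓝[E] 0) (𝓝 0) := by
    rw [Metric.tendsto_nhds]
    intro r hr
    -- With zero initial error the Grönwall bound is continuous in the defect size η and vanishes at
    -- η = 0, so a small enough consistency error brings it below `r`.
    have hg : Tendsto (fun η => gronwallBound 0 (max C 1) η t) (𝓝 0) (𝓝 0) := by
      have := (gronwallBound_continuous_ε 0 (max C 1) t).tendsto 0
      rwa [gronwallBound_ε0_δ0] at this
    obtain ⟨r', hr', hr''⟩ := Metric.eventually_nhds_iff.1 (hg.eventually_lt_const hr)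
    have hη : gronwallBound 0 (max C 1) (r' / 2) t < r := hr'' (by
      rw [dist_zero_right, Real.norm_of_nonneg (by positivity)]; linarith)
    filter_upwards [self_mem_nhdsWithin, hle eventually_scale, hle (hsmall _ (half_pos hr'))]
      with ε hεE hε hs
    rw [dist_zero_right]
    exact (norm_error_le M hΩ hT hε.1 hε.2 (hop ε hε.1 hε.2) (huε ε hεE) hu (half_pos hr').le
      (fun s hs' => hs _ (mem_image_of_mem u hs')) t ht).trans_lt hη
  refine (tendsto_zero_iff_enorm_tendsto_zero.1 hnorm).congr' ?_
  filter_upwards [hle eventually_scale] with ε hε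
  rw [Lp.enorm_def]
  refine eLpNorm_congr_ae ?_
  filter_upwards [Lp.coeFn_sub (uε ε t) (S ε (u t)), (hop ε hε.1 hε.2).eval (u t)] with x h1 h2
  rw [h1, Pi.sub_apply, h2]
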